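/- All Hilbert spaces are real and separable. Let $H_N$ ($N\in\mathbb N$) and $H_\infty$ be Hilbert spaces, $\mathcal C\subset H_\infty$ a dense linear subspace, and $\Psi_N:\mathcal C\to H_N$ ($N\in\mathbb N$) linear maps with $\lim_{N\to\infty}\langle\Psi_N\varphi,\Psi_N\varphi\rangle_N=\langle\varphi,\varphi\rangle_\infty$ for every $\varphi\in\mathcal C$; let $\Psi_\infty\varphi=\varphi$. Write $\overline{\mathbb N}=\mathbb N\cup\{\infty\}$. A section is a family $(u_N)_{N\in\overline{\mathbb N}}\in\prod_{N\in\overline{\mathbb N}}H_N$. It converges strongly ($u_N\xrightarrow{s}u_\infty$) if $\langle u_N,\Psi_N\varphi\rangle_N\to\langle u_\infty,\varphi\rangle_\infty$ for all $\varphi\in\mathcal C$ and $\|u_N\|_N\to\|u_\infty\|_\infty$. It converges weakly ($u_N\rightharpoonup u_\infty$) if $\langle u_N,v_N\rangle_N\to\langle u_\infty,v_\infty\rangle_\infty$ for every strongly convergent section $(v_N)_{N\in\overline{\mathbb N}}$. The same notions apply along a strictly increasing sequence $(N_k)_{k\in\mathbb N}$ in $\mathbb N$, with the spaces $H_{N_k}$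 and the maps $\Psi_{N_k}$; an element $u\in H_\infty$ is a weak accumulation point of $(u_N)_{N\in\mathbb N}$ if $u_{N_k}\rightharpoonup u$ for some such sequence. Bounded operators $L_N$ on $H_N$ ($N\in\overline{\mathbb N}$) converge strongly ($L_N\xrightarrow{s}L_\infty$) if $u_N\xrightarrow{s}u_\infty$ implies $L_Nu_N\xrightarrow{s}L_\infty u_\infty$. For each $N\in\overline{\mathbb N}$ let $(G^N_\alpha)_{\alpha>0}$ be a strongly continuous contraction resolvent of symmetric operators on $H_N$, i.e. $G^N_\alpha$ is bounded and symmetric, $\|\alpha G^N_\alpha\|\le1$, $G^N_\alpha-G^N_\beta=(\beta-\alpha)G^N_\alpha G^N_\beta$ and $\lim_{\alpha\to\infty}\alpha G^N_\alpha u=u$. Let $\Delta_N=\mathrm{id}-(G_1^N)^{-1}$ with $\mathcal D(\Delta_N)=\mathrm{Im}(G_1^N)$ be its generator, $T^N_t=\exp(t\Delta_N)$, $t>0$, the semigroup given by functional calculus, and $(\mathcal E^N,\mathcal D(\mathcal E^N))$ the closure of the form $(u,v)\mapsto\langle u,-\Delta_Nv\rangle_N$ on $\mathcal D(\Delta_N)$.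 Set $\mathcal E^N_\alpha(u,v)=\mathcal E^N(u,v)+\alpha\langle u,v\rangle_N$, and $\mathcal E^N(u,u)=\infty$ for $u\in H_N\setminus\mathcal D(\mathcal E^N)$. Then the following are equivalent. (i) $G^N_\alpha\xrightarrow{s}G^\infty_\alpha$ for every $\alpha>0$. (ii) (a) For every section and every $\alpha>0$, $u_N\xrightarrow{s}u_\infty$ implies $\lim_{N\to\infty}\mathcal E^N_\alpha(G^N_\alpha u_N,G^N_\alpha u_N)=\mathcal E^\infty_\alpha(G^\infty_\alpha u_\infty,G^\infty_\alpha u_\infty)$. (b) For every $u\in\mathcal D(\mathcal E^\infty)$ there are $u_N\in\mathcal D(\mathcal E^N)$, $N\in\mathbb N$, with $u_N\xrightarrow{s}u$ and $\lim_{N\to\infty}\mathcal E^N(u_N,u_N)=\mathcal E^\infty(u,u)$. (iii) (a) For every section, $u_N\rightharpoonup u_\infty$ implies $\mathcal E^\infty(u_\infty,u_\infty)\le\liminf_{N\to\infty}\mathcal E^N(u_N,u_N)$ in $[0,\infty]$. (b) There is a dense linear subspace $V$ of $(\mathcal D(\mathcal E^\infty),\mathcal E^\infty_1)$ such that for every $u\in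 V$ there are $u_N\in\mathcal D(\mathcal E^N)$, $N\in\mathbb N$, with $u_N\xrightarrow{s}u$ and $\lim_{N\to\infty}\mathcal E^N(u_N,u_N)=\mathcal E^\infty(u,u)$. (iv) (a) There is $\alpha>0$ such that for every $\varphi\in\mathcal C$, every $u\in H_\infty$ and every strictly increasing $(N_k)_{k\in\mathbb N}$ with $G^{N_k}_\alpha\Psi_{N_k}\varphi\rightharpoonup u$ (so $u$ is a weak accumulation point of $(G^N_\alpha\Psi_N\varphi)_{N\in\mathbb N}$) it holds $\mathcal E^\infty(u,u)\le\liminf_{k\to\infty}\mathcal E^{N_k}(G^{N_k}_\alpha\Psi_{N_k}\varphi,G^{N_k}_\alpha\Psi_{N_k}\varphi)$ (in particular $u\in\mathcal D(\mathcal E^\infty)$). (b) Property (b) of (iii) holds. (v) $\Delta_N^pT^N_t\xrightarrow{s}\Delta_\infty^pT^\infty_t$ for every $t>0$ and every integer $p\ge0$. -/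

import Mathlib

noncomputable section

/-- A sequence of converging Hilbert spaces `H N` with asymptotic space `Hinf`; the map with index
`∞` is the inclusion of `C` into `Hinf`. -/
structure ConvergingHilbertSpaces (H : ℕ → Type*) (Hinf : Type*)
    [∀ N, NormedAddCommGroup (H N)] [∀ N, InnerProductSpace ℝ (H N)]
    [NormedAddCommGroup Hinf] [InnerProductSpace ℝ Hinf] where
  C : Submodule ℝ Hinf
  dense_C : Dense (C : Set Hinf)
  Ψ : ∀ N, C →ₗ[ℝ] H N
  tendsto_inner : ∀ φ : C, Filter.Tendsto (fun N => inner ℝ (Ψ N φ) (Ψ N φ)) Filter.atTop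
    (nhds (inner ℝ (φ : Hinf) (φ : Hinf)))

namespace ConvergingHilbertSpaces

variable {H : ℕ → Type*} {Hinf : Type*}
  [∀ N, NormedAddCommGroup (H N)] [∀ N, InnerProductSpace ℝ (H N)]
  [NormedAddCommGroup Hinf] [InnerProductSpace ℝ Hinf]

/-- The section `(u, uinf)` is strongly convergent. -/
def StronglyConverges (S : ConvergingHilbertSpaces H Hinf) (u : ∀ N, H N) (uinf : Hinf) : Prop :=
  (∀ φ : S.C, Filter.Tendsto (fun N => inner ℝ (u N) (S.Ψ N φ)) Filter.atTop
    (nhds (inner ℝ uinf (φ : Hinf)))) ∧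
  Filter.Tendsto (fun N => ‖u N‖) Filter.atTop (nhds ‖uinf‖)

/-- The section `(u, uinf)` is weakly convergent. -/
def WeaklyConverges (S : ConvergingHilbertSpaces H Hinf) (u : ∀ N, H N) (uinf : Hinf) : Prop :=
  ∀ (v : ∀ N, H N) (vinf : Hinf), S.StronglyConverges v vinf →
    Filter.Tendsto (fun N => inner ℝ (u N) (v N)) Filter.atTop (nhds (inner ℝ uinf vinf))

/-- The section `(L, Linf)` of bounded operators is strongly convergent. -/
def OpStronglyConverges (S : ConvergingHilbertSpaces H Hinf) (L : ∀ N, H N →L[ℝ] H N)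
    (Linf : Hinf →L[ℝ] Hinf) : Prop :=
  ∀ (u : ∀ N, H N) (uinf : Hinf), S.StronglyConverges u uinf →
    S.StronglyConverges (fun N => L N (u N)) (Linf uinf)

/-- The converging Hilbert spaces along a subsequence. The convergence of a subsection
`(u (n k))` is the convergence of a section of `S.subseq n hn`. -/
def subseq (S : ConvergingHilbertSpaces H Hinf) (n : ℕ → ℕ) (hn : StrictMono n) :
    ConvergingHilbertSpaces (fun k => H (n k)) Hinf where
  C := S.C
  dense_C := S.dense_C
  Ψ k := S.Ψ (n k)
  tendsto_inner φ := (S.tendsto_inner φ).comp hn.tendsto_atTop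

end ConvergingHilbertSpaces

section FunctionalCalculus

variable {H : Type*} [NormedAddCommGroup H] [InnerProductSpace ℝ H]

/-- Continuous functional calculus on a real Hilbert space for a symmetric operator `A` with
`0 ≤ A ≤ 1`: the continuous extension of `p ↦ p(A)` from polynomials to `C([0, 1])`. -/
def unitCalculus [CompleteSpace H] (A : H →L[ℝ] H) : C(unitInterval, ℝ) →L[ℝ] (H →L[ℝ] H) :=
  (Polynomial.aeval (R := ℝ) A).toLinearMap.extendOfNorm
    (Polynomial.toContinuousMapOnAlgHom unitInterval).toLinearMap

theorem aeval_symm {A : H →L[ℝ] H} (hA : ∀ u v, inner ℝ (A u) v = inner ℝ u (A v))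
    (p : Polynomial ℝ) (u v : H) :
    inner ℝ (Polynomial.aeval A p u) v = inner ℝ u (Polynomial.aeval A p v) := by
  induction p using Polynomial.induction_on' generalizing u v with
  | add p q hp hq => simp [inner_add_left, inner_add_right, hp, hq]
  | monomial n a =>
    have h : ∀ n u v, inner ℝ ((A ^ n) u) v = inner ℝ u ((A ^ n) v) := by
      intro n
      induction n with
      | zero => simp
      | succ n ih =>
        intro u v
        rw [pow_succ, mul_apply_eq_comp, ih, hA, ← mul_apply_eq_comp,
          ← pow_succ', ← pow_succ]
    rw [Polynomial.aeval_monomial, Algebra.algebraMap_eq_smul_one, smul_mul_assoc, one_mul,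
      smul_apply, smul_apply, inner_smul_left, inner_smul_right, h]
    simp

theorem lowerBound_of_irreducible {A : H →L[ℝ] H}
    (hA : ∀ u v, inner ℝ (A u) v = inner ℝ u (A v))
    (h0 : ∀ u, 0 ≤ inner ℝ (A u) u) (h1 : ∀ u, inner ℝ (A u) u ≤ ‖u‖ ^ 2)
    {p : Polynomial ℝ} (hp : Irreducible p) (hroot : ∀ x ∈ unitInterval, p.eval x ≠ 0) :
    ∃ c > 0, ∀ u, c * ‖u‖ ≤ ‖Polynomial.aeval A p u‖ := by
  -- it is enough to bound the numerical range away from zero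
  have num : ∀ (B : H →L[ℝ] H) (c : ℝ), (∀ u, c * ‖u‖ ^ 2 ≤ |inner ℝ (B u) u|) →
      ∀ u, c * ‖u‖ ≤ ‖B u‖ := by
    intro B c h u
    rcases eq_or_ne u 0 with rfl | hu
    · simp
    · have h2 := (h u).trans (abs_real_inner_le_norm _ _)
      have : 0 < ‖u‖ := norm_pos_iff.2 hu
      rw [pow_two, ← mul_assoc] at h2
      exact le_of_mul_le_mul_right h2 this
  have hq := Polynomial.eq_quadratic_of_degree_le_two hp.degree_le_two
  set a := p.coeff 2
  set b := p.coeff 1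
  set c := p.coeff 0
  have happ : ∀ u, Polynomial.aeval A p u = a • A (A u) + b • A u + c • u := by
    intro u
    rw [hq]
    simp [Algebra.algebraMap_eq_smul_one, pow_two]
  have hev : ∀ x, p.eval x = a * x ^ 2 + b * x + c := by
    intro x
    rw [hq]
    simp
  have hin : ∀ u, inner ℝ (Polynomial.aeval A p u) u
      = a * ‖A u‖ ^ 2 + b * inner ℝ (A u) u + c * ‖u‖ ^ 2 := by
    intro u
    rw [happ, inner_add_left, inner_add_left, inner_smul_left, inner_smul_left, inner_smul_left,
      hA (A u) u, real_inner_self_eq_norm_sq, real_inner_self_eq_norm_sq]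
    simp
  by_cases ha : a = 0
  · -- linear factor
    have hc : c ≠ 0 := by simpa [hev] using hroot 0 (by simp)
    have hbc : b + c ≠ 0 := by simpa [hev, ha] using hroot 1 (by simp)
    have hsgn : 0 < c * (b + c) := by
      by_contra hneg
      have hneg' : c * (b + c) < 0 := lt_of_le_of_ne (not_lt.1 hneg) (mul_ne_zero hc hbc)
      have hcb : c * b < 0 := by nlinarith [sq_nonneg c]
      have hb : b ≠ 0 := by intro hb; simp [hb] at hcb
      refine hroot (-c / b) ?_ (by rw [hev, ha]; field_simp; ring)
      constructor
      · have : -c / b = -(c * b) / b ^ 2 := by field_simp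
        rw [this]
        have : 0 ≤ -(c * b) := by linarith
        positivity
      · have hb2 : 0 < b ^ 2 := by positivity
        have : -c / b = -(c * b) / b ^ 2 := by field_simp
        rw [this, div_le_one hb2]
        nlinarith [sq_nonneg (b + c), sq_nonneg c]
    refine ⟨min |c| |b + c|, lt_min (abs_pos.2 hc) (abs_pos.2 hbc), num _ _ fun u => ?_⟩
    rw [hin, ha]
    have e0 := h0 u
    have e1 := h1 u
    have hm : ∀ m : ℝ, m ≤ |c| → m ≤ |b + c| →
        m * ‖u‖ ^ 2 ≤ |0 * ‖A u‖ ^ 2 + b * inner ℝ (A u) u + c * ‖u‖ ^ 2| := by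
      intro m hm1 hm2
      rcases lt_or_gt_of_ne hc with hc' | hc'
      · have : b + c < 0 := by nlinarith
        rw [abs_of_neg hc'] at hm1
        rw [abs_of_neg this] at hm2
        refine le_trans ?_ (neg_le_abs _)
        nlinarith
      · have : 0 < b + c := by nlinarith
        rw [abs_of_pos hc'] at hm1
        rw [abs_of_pos this] at hm2
        refine le_trans ?_ (le_abs_self _)
        nlinarith
    exact hm _ (min_le_left _ _) (min_le_right _ _)
  · -- quadratic factor without real roots
    have hnr : ∀ x, p.eval x ≠ 0 := by
      intro x hx
      have hdeg := Polynomial.degree_eq_one_of_irreducible_of_root hp hx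
      have : p.coeff 2 = 0 := Polynomial.coeff_eq_zero_of_degree_lt (by rw [hdeg]; norm_num)
      exact ha this
    have hD : b ^ 2 - 4 * a * c < 0 := by
      by_contra hD
      push Not at hD
      refine hnr ((-b + √(b ^ 2 - 4 * a * c)) / (2 * a)) ?_
      rw [hev]
      have hs := Real.sq_sqrt hD
      set d := √(b ^ 2 - 4 * a * c)
      have e : a * ((-b + d) / (2 * a)) ^ 2 + b * ((-b + d) / (2 * a)) + c
          = (d ^ 2 - (b ^ 2 - 4 * a * c)) / (4 * a) := by
        field_simp
        ring
      rw [e, hs, sub_self, zero_div]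
    refine ⟨(4 * a * c - b ^ 2) / (4 * |a|), by have := abs_pos.2 ha; apply div_pos <;> linarith,
      num _ _ fun u => ?_⟩
    rw [hin]
    have hsq : 0 ≤ ‖(2 * a) • A u + b • u‖ ^ 2 := sq_nonneg _
    rw [norm_add_sq_real, norm_smul, norm_smul, inner_smul_left, inner_smul_right, mul_pow, mul_pow,
      Real.norm_eq_abs, Real.norm_eq_abs, sq_abs, sq_abs] at hsq
    simp only [conj_trivial] at hsq
    have ha' : 0 < 4 * |a| := by have := abs_pos.2 ha; linarith
    rw [div_mul_eq_mul_div, div_le_iff₀ ha', mul_comm |_| (4 * |a|), mul_assoc 4 |a|, ← abs_mul]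
    have := le_abs_self (a * (a * ‖A u‖ ^ 2 + b * inner ℝ (A u) u + c * ‖u‖ ^ 2))
    nlinarith

theorem lowerBound_of_no_root {A : H →L[ℝ] H}
    (hA : ∀ u v, inner ℝ (A u) v = inner ℝ u (A v))
    (h0 : ∀ u, 0 ≤ inner ℝ (A u) u) (h1 : ∀ u, inner ℝ (A u) u ≤ ‖u‖ ^ 2)
    (p : Polynomial ℝ) (hroot : ∀ x ∈ unitInterval, p.eval x ≠ 0) :
    ∃ c > 0, ∀ u, c * ‖u‖ ≤ ‖Polynomial.aeval A p u‖ := by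
  induction p using WfDvdMonoid.induction_on_irreducible with
  | zero => exact absurd (by simp) (hroot 0 (by simp))
  | unit q hq =>
    obtain ⟨r, hr, rfl⟩ := Polynomial.isUnit_iff.1 hq
    refine ⟨|r|, abs_pos.2 hr.ne_zero, fun u => ?_⟩
    simp [Algebra.algebraMap_eq_smul_one, norm_smul]
  | mul q i hq hi ih =>
    obtain ⟨c, hc, hcu⟩ := ih fun x hx h => hroot x hx (by simp [h])
    obtain ⟨d, hd, hdu⟩ := lowerBound_of_irreducible hA h0 h1 hi
      fun x hx h => hroot x hx (by simp [h])
    refine ⟨d * c, mul_pos hd hc, fun u => ?_⟩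
    rw [map_mul, mul_apply_eq_comp, mul_assoc]
    exact (mul_le_mul_of_nonneg_left (hcu u) hd.le).trans (hdu _)

theorem norm_aeval_le {A : H →L[ℝ] H}
    (hA : ∀ u v, inner ℝ (A u) v = inner ℝ u (A v))
    (h0 : ∀ u, 0 ≤ inner ℝ (A u) u) (h1 : ∀ u, inner ℝ (A u) u ≤ ‖u‖ ^ 2)
    (p : Polynomial ℝ) :
    ‖Polynomial.aeval A p‖ ≤ ‖Polynomial.toContinuousMapOnAlgHom unitInterval p‖ := by
  by_contra hlt
  push Not at hlt
  set S := Polynomial.aeval A p with hS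
  set M := ‖S‖ with hM
  have hM0 : 0 < M := (norm_nonneg _).trans_lt hlt
  have hnr : ∀ x ∈ unitInterval, (Polynomial.C (M ^ 2) - p * p).eval x ≠ 0 := by
    intro x hx h
    have h2 : ‖Polynomial.toContinuousMapOnAlgHom unitInterval p ⟨x, hx⟩‖ < M :=
      (ContinuousMap.norm_coe_le_norm _ _).trans_lt hlt
    have h3 : |p.eval x| < M := by simpa using h2
    have h4 : M ^ 2 = p.eval x ^ 2 := by
      simp only [Polynomial.eval_sub, Polynomial.eval_C, Polynomial.eval_mul] at h
      linarith
    rw [← sq_abs (p.eval x)] at h4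
    nlinarith [abs_nonneg (p.eval x)]
  obtain ⟨c, hc, hcu⟩ := lowerBound_of_no_root hA h0 h1 _ hnr
  have hsymm := aeval_symm hA p
  have hbd : ∀ u, ‖S u‖ ^ 2 ≤ (M ^ 2 - c ^ 2 / M ^ 2) * ‖u‖ ^ 2 := by
    intro u
    have e1 := hcu u
    have e2 : Polynomial.aeval A (Polynomial.C (M ^ 2) - p * p) u = M ^ 2 • u - S (S u) := by
      simp [Algebra.algebraMap_eq_smul_one, hS, pow_two, mul_smul]
    rw [e2] at e1
    have e3 : (c * ‖u‖) ^ 2 ≤ ‖M ^ 2 • u - S (S u)‖ ^ 2 := by gcongr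
    rw [norm_sub_sq_real, inner_smul_left, ← hsymm, real_inner_self_eq_norm_sq, norm_smul] at e3
    simp only [conj_trivial, norm_pow, norm_norm, hM] at e3
    have e4 : ‖S (S u)‖ ^ 2 ≤ (M * ‖S u‖) ^ 2 := by
      have := S.le_opNorm (S u)
      gcongr
    rw [← hM] at e3
    have hM2 : 0 < M ^ 2 := by positivity
    have e5 : M ^ 2 * ‖S u‖ ^ 2 ≤ M ^ 2 * ((M ^ 2 - c ^ 2 / M ^ 2) * ‖u‖ ^ 2) := by
      have : M ^ 2 * ((M ^ 2 - c ^ 2 / M ^ 2) * ‖u‖ ^ 2) = (M ^ 4 - c ^ 2) * ‖u‖ ^ 2 := by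
        field_simp
      rw [this]
      nlinarith
    exact le_of_mul_le_mul_left e5 hM2
  set K := M ^ 2 - c ^ 2 / M ^ 2 with hK
  have hKM : K < M ^ 2 := by
    have : 0 < c ^ 2 / M ^ 2 := by positivity
    linarith
  have hle : M ≤ √K := by
    refine S.opNorm_le_bound (Real.sqrt_nonneg _) fun u => ?_
    rw [← Real.sqrt_sq (norm_nonneg u), ← Real.sqrt_mul' _ (sq_nonneg _)]
    exact Real.le_sqrt_of_sq_le (hbd u)
  have : √K < M := (Real.sqrt_lt' hM0).2 hKM
  linarith

theorem denseRange_toContinuousMapOn :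
    DenseRange (Polynomial.toContinuousMapOnAlgHom unitInterval).toLinearMap := by
  have h := polynomialFunctions_closure_eq_top'
  rw [← SetLike.coe_set_eq, Subalgebra.topologicalClosure_coe, polynomialFunctions_coe] at h
  rw [DenseRange, dense_iff_closure_eq]
  simpa using h

/-- The functional calculus extends the polynomial one and is contractive. -/
theorem unitCalculus_polynomial [CompleteSpace H] {A : H →L[ℝ] H}
    (hA : ∀ u v, inner ℝ (A u) v = inner ℝ u (A v))
    (h0 : ∀ u, 0 ≤ inner ℝ (A u) u) (h1 : ∀ u, inner ℝ (A u) u ≤ ‖u‖ ^ 2) (p : Polynomial ℝ) :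
    unitCalculus A (Polynomial.toContinuousMapOnAlgHom unitInterval p) = Polynomial.aeval A p :=
  LinearMap.extendOfNorm_eq denseRange_toContinuousMapOn
    ⟨1, fun p => by simpa using norm_aeval_le hA h0 h1 p⟩ p

theorem norm_unitCalculus_le [CompleteSpace H] {A : H →L[ℝ] H}
    (hA : ∀ u v, inner ℝ (A u) v = inner ℝ u (A v))
    (h0 : ∀ u, 0 ≤ inner ℝ (A u) u) (h1 : ∀ u, inner ℝ (A u) u ≤ ‖u‖ ^ 2) (f : C(unitInterval, ℝ)) :
    ‖unitCalculus A f‖ ≤ ‖f‖ := by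
  have h := LinearMap.norm_extendOfNorm_apply_le denseRange_toContinuousMapOn 1
    (f := (Polynomial.aeval (R := ℝ) A).toLinearMap)
    (fun p => by simpa using norm_aeval_le hA h0 h1 p) f
  rwa [one_mul] at h

end FunctionalCalculus

/-- The function `s ↦ exp (t (1 - 1 / s))` on `[0, 1]`, extended by `0` at `s = 0`. -/
def expSymbol (t : ℝ) (ht : 0 < t) : C(unitInterval, ℝ) where
  toFun s := if (s : ℝ) = 0 then 0 else Real.exp (t * (1 - 1 / (s : ℝ)))
  continuous_toFun := by
    rw [continuous_iff_continuousAt]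
    intro s
    by_cases hs : (s : ℝ) = 0
    · have key : Filter.Tendsto (fun s : ℝ => Real.exp (t * (1 - 1 / s)))
          (nhdsWithin 0 (Set.Ioi 0)) (nhds 0) := by
        refine Real.tendsto_exp_atBot.comp ?_
        refine Filter.Tendsto.const_mul_atBot ht ?_
        simp only [one_div, sub_eq_add_neg]
        exact Filter.tendsto_atBot_add_const_left _ _
          (Filter.tendsto_neg_atTop_atBot.comp tendsto_inv_nhdsGT_zero)
      rw [ContinuousAt]
      simp only [hs, if_true]
      rw [Metric.tendsto_nhds]
      intro ε hε
      have h2 := (Metric.tendsto_nhds.1 key) ε hε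
      rw [eventually_nhdsWithin_iff] at h2
      have h3 : Filter.Tendsto (fun x : unitInterval => (x : ℝ)) (nhds s) (nhds 0) := by
        rw [← hs]
        exact continuous_subtype_val.continuousAt
      filter_upwards [h3.eventually h2] with x hx
      by_cases hx0 : (x : ℝ) = 0
      · simpa [hx0] using hε
      · rw [if_neg hx0]
        exact hx (lt_of_le_of_ne x.2.1 (Ne.symm hx0))
    · have h3 : ContinuousAt (fun x : unitInterval => Real.exp (t * (1 - 1 / (x : ℝ)))) s := by
        have : ContinuousAt (fun x : unitInterval => (x : ℝ)) s :=
          continuous_subtype_val.continuousAt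
        fun_prop (disch := assumption)
      refine h3.congr ?_
      have : ∀ᶠ x : unitInterval in nhds s, (x : ℝ) ≠ 0 :=
        continuous_subtype_val.continuousAt.eventually_ne hs
      filter_upwards [this] with x hx
      rw [if_neg hx]

/-- A strongly continuous contraction resolvent of symmetric operators on a real Hilbert space.
Only the values `G α` with `0 < α` matter. -/
structure ContractionResolvent (H : Type*) [NormedAddCommGroup H] [InnerProductSpace ℝ H] where
  G : ℝ → H →L[ℝ] H
  symm : ∀ α, 0 < α → ∀ u v, inner ℝ (G α u) v = inner ℝ u (G α v)
  contraction : ∀ α, 0 < α → ‖α • G α‖ ≤ 1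
  resolvent_eq : ∀ α β, 0 < α → 0 < β → G α - G β = (β - α) • (G α ∘L G β)
  strongly_continuous : ∀ u, Filter.Tendsto (fun α => α • G α u) Filter.atTop (nhds u)

namespace ContractionResolvent

variable {H : Type*} [NormedAddCommGroup H] [InnerProductSpace ℝ H]

theorem resolvent_apply (R : ContractionResolvent H) {α β : ℝ} (hα : 0 < α) (hβ : 0 < β) (u : H) :
    R.G α u = R.G β (u + (β - α) • R.G α u) := by
  have h := congrArg (fun T : H →L[ℝ] H => T u) (R.resolvent_eq β α hβ hα)
  simp only [sub_apply, smul_apply,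
    ContinuousLinearMap.comp_apply] at h
  rw [map_add, map_smul, ← sub_eq_iff_eq_add', ← neg_sub (R.G β u), h, ← neg_smul, neg_sub]

theorem injective_G_one (R : ContractionResolvent H) : Function.Injective (R.G 1) := by
  rw [injective_iff_map_eq_zero]
  intro u hu
  refine tendsto_nhds_unique (R.strongly_continuous u) ?_
  refine tendsto_const_nhds.congr' ?_
  filter_upwards [Filter.eventually_gt_atTop 0] with α hα
  have h := congrArg (fun T : H →L[ℝ] H => T u) (R.resolvent_eq α 1 hα one_pos)
  simp only [sub_apply, smul_apply,
    ContinuousLinearMap.comp_apply, hu, map_zero, smul_zero, sub_zero] at h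
  simp [h]

/-- The operator `G 1` satisfies `(G 1)² ≤ G 1`. -/
theorem inner_sub_nonneg (R : ContractionResolvent H) (u : H) :
    0 ≤ inner ℝ (R.G 1 u) (u - R.G 1 u) := by
  set w := R.G 1 u with hw
  have key : ∀ β : ℝ, 0 < β → 0 ≤ ‖u - w‖ ^ 2 * β⁻¹ + 2 * inner ℝ w (u - w) := by
    intro β hβ
    have h1 : w = R.G β (u + (β - 1) • w) := R.resolvent_apply one_pos hβ u
    have h2 : ‖β • w‖ ≤ ‖(u - w) + β • w‖ := by
      have h3 := (β • R.G β).le_of_opNorm_le (R.contraction β hβ) (u + (β - 1) • w)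
      rw [smul_apply, ← h1, one_mul] at h3
      have h0 : (u - w) + β • w = u + (β - 1) • w := by module
      rw [h0]
      exact h3
    have h4 : ‖β • w‖ ^ 2 ≤ ‖(u - w) + β • w‖ ^ 2 := by gcongr
    rw [norm_add_sq_real, inner_smul_right, real_inner_comm] at h4
    have h5 : 0 ≤ ‖u - w‖ ^ 2 + 2 * (β * inner ℝ w (u - w)) := by linarith
    have h6 : ‖u - w‖ ^ 2 * β⁻¹ + 2 * inner ℝ w (u - w)
        = β⁻¹ * (‖u - w‖ ^ 2 + 2 * (β * inner ℝ w (u - w))) := by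
      field_simp
    rw [h6]
    positivity
  have hlim : Filter.Tendsto (fun β : ℝ => ‖u - w‖ ^ 2 * β⁻¹ + 2 * inner ℝ w (u - w)) Filter.atTop
      (nhds (‖u - w‖ ^ 2 * 0 + 2 * inner ℝ w (u - w))) :=
    (tendsto_inv_atTop_zero.const_mul _).add_const _
  have := ge_of_tendsto hlim ((Filter.eventually_gt_atTop 0).mono key)
  linarith

/-- The generator `Δ = id - (G 1)⁻¹` with domain the range of `G 1`. -/
def generator (R : ContractionResolvent H) : H →ₗ.[ℝ] H where
  domain := LinearMap.range (R.G 1 : H →ₗ[ℝ] H)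
  toFun := (LinearMap.range (R.G 1 : H →ₗ[ℝ] H)).subtype -
    ((LinearEquiv.ofInjective (R.G 1 : H →ₗ[ℝ] H) R.injective_G_one).symm : _ →ₗ[ℝ] H)

theorem generator_G_one (R : ContractionResolvent H) (u : H) (h : R.G 1 u ∈ R.generator.domain) :
    R.generator ⟨R.G 1 u, h⟩ = R.G 1 u - u := by
  have : (LinearEquiv.ofInjective (R.G 1 : H →ₗ[ℝ] H) R.injective_G_one).symm ⟨R.G 1 u, h⟩ = u := by
    rw [LinearEquiv.symm_apply_eq]
    rfl
  change R.G 1 u - (LinearEquiv.ofInjective (R.G 1 : H →ₗ[ℝ] H) R.injective_G_one).symm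
    ⟨R.G 1 u, h⟩ = _
  rw [this]

/-- `u` belongs to the domain of the power `Δ ^ p` and `Δ ^ p u = w`. -/
def GeneratorPow (R : ContractionResolvent H) : ℕ → H → H → Prop
  | 0, u, w => u = w
  | p + 1, u, w => ∃ h : u ∈ R.generator.domain, R.GeneratorPow p (R.generator ⟨u, h⟩) w

/-- The bilinear form `(u, v) ↦ ⟨u, -Δ v⟩` on the domain of the generator. -/
def preForm (R : ContractionResolvent H) : LinearMap.BilinForm ℝ R.generator.domain :=
  (innerₗ H).compl₁₂ R.generator.domain.subtype (-R.generator.toFun)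

theorem preForm_apply (R : ContractionResolvent H) (u v : R.generator.domain) :
    R.preForm u v = inner ℝ (u : H) (-R.generator v) := rfl

theorem preForm_symm (R : ContractionResolvent H) (u v : R.generator.domain) :
    R.preForm u v = R.preForm v u := by
  obtain ⟨_, ⟨a, rfl⟩⟩ := u
  obtain ⟨_, ⟨b, rfl⟩⟩ := v
  rw [preForm_apply, preForm_apply]
  simp only [ContinuousLinearMap.coe_coe, generator_G_one, neg_sub, inner_sub_right]
  rw [R.symm 1 one_pos a b, real_inner_comm a (R.G 1 b), real_inner_comm (R.G 1 a) (R.G 1 b)]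

theorem preForm_nonneg (R : ContractionResolvent H) (u : R.generator.domain) :
    0 ≤ R.preForm u u := by
  obtain ⟨_, ⟨a, rfl⟩⟩ := u
  rw [preForm_apply]
  simp only [ContinuousLinearMap.coe_coe, generator_G_one, neg_sub]
  exact R.inner_sub_nonneg a

/-- The sequence `x` in the domain of `Δ` is Cauchy for the form `⟨u, -Δ v⟩` and converges to `u`
in `H`. -/
structure IsApprox (R : ContractionResolvent H) (x : ℕ → R.generator.domain) (u : H) : Prop where
  tendsto : Filter.Tendsto (fun n => (x n : H)) Filter.atTop (nhds u)
  cauchy : ∀ ε : ℝ, 0 < ε → ∃ n₀, ∀ m ≥ n₀, ∀ n ≥ n₀, R.preForm (x m - x n) (x m - x n) < ε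

theorem preForm_add_le (R : ContractionResolvent H) (u v : R.generator.domain) :
    R.preForm (u + v) (u + v) ≤ 2 * R.preForm u u + 2 * R.preForm v v := by
  have h := R.preForm_nonneg (u - v)
  simp only [map_add, map_sub, LinearMap.add_apply, LinearMap.sub_apply] at h ⊢
  linarith

theorem IsApprox.add {R : ContractionResolvent H} {x y : ℕ → R.generator.domain} {u v : H}
    (hx : R.IsApprox x u) (hy : R.IsApprox y v) : R.IsApprox (fun n => x n + y n) (u + v) := by
  refine ⟨by simpa using hx.tendsto.add hy.tendsto, fun ε hε => ?_⟩
  obtain ⟨a, ha⟩ := hx.cauchy (ε / 4) (by positivity)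
  obtain ⟨b, hb⟩ := hy.cauchy (ε / 4) (by positivity)
  refine ⟨max a b, fun m hm n hn => ?_⟩
  have h := R.preForm_add_le (x m - x n) (y m - y n)
  have h1 := ha m (le_of_max_le_left hm) n (le_of_max_le_left hn)
  have h2 := hb m (le_of_max_le_right hm) n (le_of_max_le_right hn)
  rw [add_sub_add_comm]
  linarith

theorem IsApprox.smul {R : ContractionResolvent H} {x : ℕ → R.generator.domain} {u : H} (c : ℝ)
    (hx : R.IsApprox x u) : R.IsApprox (fun n => c • x n) (c • u) := by
  refine ⟨by simpa using hx.tendsto.const_smul c, fun ε hε => ?_⟩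
  obtain ⟨a, ha⟩ := hx.cauchy (ε / (c ^ 2 + 1)) (by positivity)
  refine ⟨a, fun m hm n hn => ?_⟩
  have h1 := ha m hm n hn
  rw [lt_div_iff₀ (by positivity)] at h1
  have h2 := R.preForm_nonneg (x m - x n)
  simp only [← smul_sub, map_smul, LinearMap.smul_apply, smul_eq_mul]
  nlinarith

theorem isApprox_const (R : ContractionResolvent H) (u : R.generator.domain) :
    R.IsApprox (fun _ => u) u :=
  ⟨tendsto_const_nhds, fun ε hε => ⟨0, fun m _ n _ => by simpa using hε⟩⟩

/-- The domain of the closure of the form `⟨u, -Δ v⟩`. -/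
def formDomain (R : ContractionResolvent H) : Submodule ℝ H where
  carrier := {u | ∃ x, R.IsApprox x u}
  add_mem' := fun ⟨_, hx⟩ ⟨_, hy⟩ => ⟨_, hx.add hy⟩
  zero_mem' := ⟨_, R.isApprox_const 0⟩
  smul_mem' := fun c _ ⟨_, hx⟩ => ⟨_, hx.smul c⟩

/-- The form is closable. -/
theorem IsApprox.tendsto_zero {R : ContractionResolvent H} {z : ℕ → R.generator.domain}
    (hz : R.IsApprox z 0) : Filter.Tendsto (fun n => R.preForm (z n) (z n)) Filter.atTop
      (nhds 0) := by
  rw [Metric.tendsto_atTop]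
  intro ε hε
  obtain ⟨a, ha⟩ := hz.cauchy (ε / 2) (by positivity)
  refine ⟨a, fun n hn => ?_⟩
  rw [Real.dist_eq, sub_zero, abs_of_nonneg (R.preForm_nonneg _)]
  have hlim : Filter.Tendsto (fun m => ε / 2 + 2 * R.preForm (z m) (z n)) Filter.atTop
      (nhds (ε / 2 + 2 * 0)) := by
    refine (Filter.Tendsto.const_mul _ ?_).const_add _
    have := hz.tendsto.inner (𝕜 := ℝ) (tendsto_const_nhds (x := -R.generator (z n)))
    simpa [preForm_apply] using this
  have : R.preForm (z n) (z n) ≤ ε / 2 + 2 * 0 := by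
    refine ge_of_tendsto hlim ?_
    filter_upwards [Filter.eventually_ge_atTop a] with m hm
    have h1 := ha m hm n hn
    have h2 := R.preForm_nonneg (z m)
    have h3 := R.preForm_symm (z n) (z m)
    simp only [map_sub, LinearMap.sub_apply] at h1
    linarith
  linarith

theorem sqrt_preForm_add_le (R : ContractionResolvent H) (u v : R.generator.domain) :
    √(R.preForm (u + v) (u + v)) ≤ √(R.preForm u u) + √(R.preForm v v) := by
  have hcs := LinearMap.BilinForm.apply_sq_le_of_symm R.preForm R.preForm_nonneg
    ⟨fun x y => R.preForm_symm x y⟩ u v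
  have h1 := Real.sq_sqrt (R.preForm_nonneg u)
  have h2 := Real.sq_sqrt (R.preForm_nonneg v)
  rw [Real.sqrt_le_left (by positivity)]
  have h3 : R.preForm u v ≤ √(R.preForm u u) * √(R.preForm v v) := by
    refine le_of_sq_le_sq ?_ (by positivity)
    rw [mul_pow, h1, h2]
    exact hcs
  have h4 := R.preForm_symm u v
  simp only [map_add, LinearMap.add_apply]
  nlinarith

theorem abs_sqrt_preForm_sub_le (R : ContractionResolvent H) (u v : R.generator.domain) :
    |√(R.preForm u u) - √(R.preForm v v)| ≤ √(R.preForm (u - v) (u - v)) := by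
  rw [abs_le]
  have h1 := R.sqrt_preForm_add_le (u - v) v
  have h2 := R.sqrt_preForm_add_le (v - u) u
  have h3 : R.preForm (v - u) (v - u) = R.preForm (u - v) (u - v) := by
    rw [← neg_sub u v]
    simp only [map_neg, LinearMap.neg_apply, neg_neg]
  rw [sub_add_cancel] at h1 h2
  rw [h3] at h2
  constructor <;> linarith

theorem IsApprox.exists_tendsto {R : ContractionResolvent H} {x : ℕ → R.generator.domain} {u : H}
    (hx : R.IsApprox x u) :
    ∃ r, Filter.Tendsto (fun n => R.preForm (x n) (x n)) Filter.atTop (nhds r) := by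
  have hc : CauchySeq (fun n => √(R.preForm (x n) (x n))) := by
    rw [Metric.cauchySeq_iff]
    intro ε hε
    obtain ⟨a, ha⟩ := hx.cauchy (ε ^ 2) (by positivity)
    refine ⟨a, fun m hm n hn => ?_⟩
    rw [Real.dist_eq]
    refine (R.abs_sqrt_preForm_sub_le _ _).trans_lt ?_
    rw [Real.sqrt_lt' hε]
    exact ha m hm n hn
  obtain ⟨r, hr⟩ := cauchySeq_tendsto_of_complete hc
  refine ⟨r ^ 2, (hr.pow 2).congr fun n => ?_⟩
  exact Real.sq_sqrt (R.preForm_nonneg _)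

theorem IsApprox.tendsto_sub {R : ContractionResolvent H} {x y : ℕ → R.generator.domain} {u : H}
    (hx : R.IsApprox x u) (hy : R.IsApprox y u) :
    Filter.Tendsto (fun n => √(R.preForm (x n) (x n)) - √(R.preForm (y n) (y n)))
      Filter.atTop (nhds 0) := by
  have hz : R.IsApprox (fun n => x n + (-1 : ℝ) • y n) 0 := by
    simpa using hx.add (hy.smul (-1))
  have h := (Real.continuous_sqrt.tendsto 0).comp hz.tendsto_zero
  rw [Real.sqrt_zero] at h
  refine squeeze_zero_norm (fun n => ?_) h
  simpa [sub_eq_add_neg] using R.abs_sqrt_preForm_sub_le (x n) (y n)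

theorem IsApprox.tendsto_unique {R : ContractionResolvent H} {x y : ℕ → R.generator.domain} {u : H}
    (hx : R.IsApprox x u) (hy : R.IsApprox y u) {r : ℝ}
    (hr : Filter.Tendsto (fun n => R.preForm (x n) (x n)) Filter.atTop (nhds r)) :
    Filter.Tendsto (fun n => R.preForm (y n) (y n)) Filter.atTop (nhds r) := by
  have h1 := (Real.continuous_sqrt.tendsto r).comp hr
  have h2 := (h1.sub (hx.tendsto_sub hy)).pow 2
  have hr0 : 0 ≤ r := ge_of_tendsto' hr fun n => R.preForm_nonneg _
  rw [sub_zero, Real.sq_sqrt hr0] at h2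
  refine h2.congr fun n => ?_
  simp [Real.sq_sqrt (R.preForm_nonneg _)]

/-- A sequence that defines the value of the closed form at an element of its domain. -/
def approxSeq (R : ContractionResolvent H) (u : R.formDomain) : ℕ → R.generator.domain :=
  Classical.choose u.2

theorem isApprox_approxSeq (R : ContractionResolvent H) (u : R.formDomain) :
    R.IsApprox (R.approxSeq u) u := Classical.choose_spec u.2

theorem preForm_polar (R : ContractionResolvent H) (u v : R.generator.domain) :
    R.preForm u v = (R.preForm (u + v) (u + v) -
      R.preForm (u + (-1 : ℝ) • v) (u + (-1 : ℝ) • v)) / 4 := by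
  have h := R.preForm_symm u v
  simp only [map_add, LinearMap.add_apply, neg_smul, one_smul, map_neg, LinearMap.neg_apply]
  linarith

/-- The value of the closed form: the limit of the form along approximating sequences. -/
def formValue (R : ContractionResolvent H) (u v : R.formDomain) : ℝ :=
  Filter.limUnder Filter.atTop fun n => R.preForm (R.approxSeq u n) (R.approxSeq v n)

theorem tendsto_formValue (R : ContractionResolvent H) {x y : ℕ → R.generator.domain}
    {u v : R.formDomain} (hx : R.IsApprox x u) (hy : R.IsApprox y v) :
    Filter.Tendsto (fun n => R.preForm (x n) (y n)) Filter.atTop (nhds (R.formValue u v)) := by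
  have hu := R.isApprox_approxSeq u
  have hv := R.isApprox_approxSeq v
  obtain ⟨r, hr⟩ := (hu.add hv).exists_tendsto
  obtain ⟨s, hs⟩ := (hu.add (hv.smul (-1))).exists_tendsto
  have h1 : Filter.Tendsto (fun n => R.preForm (R.approxSeq u n) (R.approxSeq v n)) Filter.atTop
      (nhds ((r - s) / 4)) :=
    ((hr.sub hs).div_const 4).congr fun n => (R.preForm_polar _ _).symm
  rw [formValue, h1.limUnder_eq]
  have hr' := (hu.add hv).tendsto_unique (hx.add hy) hr
  have hs' := (hu.add (hv.smul (-1))).tendsto_unique (hx.add (hy.smul (-1))) hs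
  exact ((hr'.sub hs').div_const 4).congr fun n => (R.preForm_polar _ _).symm

theorem formValue_symm (R : ContractionResolvent H) (u v : R.formDomain) :
    R.formValue u v = R.formValue v u := by
  refine tendsto_nhds_unique
    (R.tendsto_formValue (R.isApprox_approxSeq u) (R.isApprox_approxSeq v)) ?_
  exact (R.tendsto_formValue (R.isApprox_approxSeq v) (R.isApprox_approxSeq u)).congr
    fun n => R.preForm_symm _ _

theorem formValue_add (R : ContractionResolvent H) (u u' v : R.formDomain) :
    R.formValue (u + u') v = R.formValue u v + R.formValue u' v := by
  refine tendsto_nhds_unique (R.tendsto_formValue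
    ((R.isApprox_approxSeq u).add (R.isApprox_approxSeq u')) (R.isApprox_approxSeq v)) ?_
  simpa using (R.tendsto_formValue (R.isApprox_approxSeq u) (R.isApprox_approxSeq v)).add
    (R.tendsto_formValue (R.isApprox_approxSeq u') (R.isApprox_approxSeq v))

theorem formValue_smul (R : ContractionResolvent H) (c : ℝ) (u v : R.formDomain) :
    R.formValue (c • u) v = c • R.formValue u v := by
  refine tendsto_nhds_unique (R.tendsto_formValue
    ((R.isApprox_approxSeq u).smul c) (R.isApprox_approxSeq v)) ?_
  simpa using (R.tendsto_formValue (R.isApprox_approxSeq u) (R.isApprox_approxSeq v)).const_mul c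

/-- The closed form `ℰ`, the closure of `⟨u, -Δ v⟩`. -/
def form (R : ContractionResolvent H) : LinearMap.BilinForm ℝ R.formDomain :=
  LinearMap.mk₂ ℝ R.formValue R.formValue_add R.formValue_smul
    (fun u v v' => by
      rw [R.formValue_symm u, R.formValue_add, R.formValue_symm v, R.formValue_symm v'])
    (fun c u v => by rw [R.formValue_symm u, R.formValue_smul, R.formValue_symm v])

/-- The form `ℰ_α(u, v) = ℰ(u, v) + α ⟨u, v⟩`. -/
def formShift (R : ContractionResolvent H) (α : ℝ) (u v : R.formDomain) : ℝ :=
  R.form u v + α * inner ℝ (u : H) (v : H)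

open Classical in
/-- The energy `ℰ(u, u)`, with the value `∞` outside the domain of the form. -/
def energy (R : ContractionResolvent H) (u : H) : EReal :=
  if h : u ∈ R.formDomain then ((R.form ⟨u, h⟩ ⟨u, h⟩ : ℝ) : EReal) else ⊤

theorem G_mem_formDomain (R : ContractionResolvent H) {α : ℝ} (hα : 0 < α) (u : H) :
    R.G α u ∈ R.formDomain := by
  rw [R.resolvent_apply hα one_pos]
  exact ⟨_, R.isApprox_const ⟨R.G 1 (u + (1 - α) • R.G α u), ⟨_, rfl⟩⟩⟩

/-- The linear subspace `V` is dense in the domain of the form for the norm `ℰ_1 ^ (1/2)`. -/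
def FormDense (R : ContractionResolvent H) (V : Submodule ℝ R.formDomain) : Prop :=
  ∀ u : R.formDomain, ∀ ε : ℝ, 0 < ε → ∃ v ∈ V, √(R.formShift 1 (u - v) (u - v)) < ε

/-- The bounded operator `L` is `Δ ^ p T`: every `T u` belongs to the domain of `Δ ^ p`, and
`Δ ^ p (T u) = L u`. -/
def IsGeneratorPowComp (R : ContractionResolvent H) (p : ℕ) (T L : H →L[ℝ] H) : Prop :=
  ∀ u, R.GeneratorPow p (T u) (L u)

/-- The semigroup `T t = exp (t Δ)`. Since `Δ = id - (G 1)⁻¹`, it is the function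
`s ↦ exp (t (1 - 1 / s))` of the operator `G 1`. -/
def semigroup [CompleteSpace H] (R : ContractionResolvent H) (t : ℝ) (ht : 0 < t) : H →L[ℝ] H :=
  unitCalculus (R.G 1) (expSymbol t ht)

end ContractionResolvent

/-- There are `w N` in the domains of the forms that converge strongly to `u` and whose energies
converge to the energy of `u`. -/
def RecoverySequence {H : ℕ → Type*} {Hinf : Type*}
    [∀ N, NormedAddCommGroup (H N)] [∀ N, InnerProductSpace ℝ (H N)]
    [NormedAddCommGroup Hinf] [InnerProductSpace ℝ Hinf] (S : ConvergingHilbertSpaces H Hinf)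
    (R : ∀ N, ContractionResolvent (H N)) (Rinf : ContractionResolvent Hinf)
    (u : Rinf.formDomain) : Prop :=
  ∃ w : ∀ N, (R N).formDomain,
    S.StronglyConverges (fun N => (w N : H N)) (u : Hinf) ∧
    Filter.Tendsto (fun N => (R N).form (w N) (w N)) Filter.atTop (nhds (Rinf.form u u))

end

section

open Filter Topology

/-! Everything rests on one quadratic identity: `G α u` minimizes `v ↦ ℰ_α(v, v) - 2⟨v, u⟩`, and the
excess of `v` over the minimum is `ℰ_α(v - G α u, v - G α u)` (`formShift_sub_G`). In particular
`ℰ_α(G α u, G α u) = ⟨G α u, u⟩`, so convergence of resolvents gives convergence of their energies.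
Conversely, a recovery sequence for `G α u` has excess tending to zero, and since `ℰ_α` dominates
`α‖·‖²` it is asymptotic to the resolvents themselves.

The bridge from resolvents to forms is the Yosida approximation: `β⟨u, u - β G β u⟩` is at most
`ℰ(u, u)`, and a bound uniform in `β` bounds `ℰ(u, u)`. For fixed `β` these convex forms involve
only `G β`, so strong convergence of resolvents makes them lower semicontinuous along weakly
convergent sections. The vectors `β G β u`, with `β → ∞` along a diagonal, are recovery sequences.

From (iv) back to (i), weak compactness yields weak limits of `G α (Ψ N φ)`. Lower semicontinuity
and recovery on a dense subspace force such a limit to have the minimal value of the limit problem,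
hence to be `G α φ`. Equality of the values then forces convergence of the norms
(`eq_G_and_tendsto_norm_of_weaklyConverges`).

For (v), the symbols `f` on `[0, 1]` for which `f(G 1)` converges strongly form a closed unital
subalgebra. By Stone–Weierstrass a single injective member makes it everything. The symbol `s` of `G
1` and the symbol `exp(t(1 - 1/s))` of the semigroup are both injective, so each convergence implies
the other. -/

theorem tendsto_of_approx {x : ℕ → ℝ} {a : ℝ}
    (h : ∀ ε : ℝ, 0 < ε → ∃ (y : ℕ → ℝ) (b : ℝ), Tendsto y atTop (𝓝 b) ∧ |b - a| ≤ ε ∧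
      ∀ᶠ N in atTop, |x N - y N| ≤ ε) : Tendsto x atTop (𝓝 a) := by
  rw [Metric.tendsto_nhds]
  intro ε hε
  obtain ⟨y, b, hy, hb, hxy⟩ := h (ε / 4) (by positivity)
  filter_upwards [hxy, (Metric.tendsto_nhds.1 hy) (ε / 4) (by positivity)] with N h1 h2
  rw [Real.dist_eq] at *
  rw [abs_le] at h1 hb
  rw [abs_lt] at *
  constructor <;> linarith [h1.1, h1.2, hb.1, hb.2, h2.1, h2.2]

/-- A diagonal selection: eventual properties `P m` hold for an index `m` tending to infinity. -/
theorem exists_tendsto_atTop_diagonal {P : ℕ → ℕ → Prop} (h : ∀ m, ∀ᶠ N in atTop, P m N) :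
    ∃ m : ℕ → ℕ, Tendsto m atTop atTop ∧ ∀ᶠ N in atTop, P (m N) N := by
  classical
  choose K hK using fun m => eventually_atTop.1 (h m)
  -- `m N` is the largest `m ≤ N` whose threshold `K m` has been passed; the cap `m ≤ N` guarantees
  -- that a largest one exists.
  refine ⟨fun N => Nat.findGreatest (fun m => K m ≤ N) N, ?_, ?_⟩
  · rw [tendsto_atTop]
    intro b
    filter_upwards [eventually_ge_atTop b, eventually_ge_atTop (K b)] with N h1 h2
    exact Nat.le_findGreatest h1 h2
  · filter_upwards [eventually_ge_atTop (K 0)] with N hN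
    exact hK _ N (Nat.findGreatest_spec (P := fun m => K m ≤ N) (Nat.zero_le N) hN)

/-! ### Strong and weak convergence of sections -/

namespace ConvergingHilbertSpaces

variable {H : ℕ → Type*} {Hinf : Type*}
  [∀ N, NormedAddCommGroup (H N)] [∀ N, InnerProductSpace ℝ (H N)]
  [NormedAddCommGroup Hinf] [InnerProductSpace ℝ Hinf]
  {S : ConvergingHilbertSpaces H Hinf}

theorem tendsto_norm_Ψ (S : ConvergingHilbertSpaces H Hinf) (φ : S.C) :
    Tendsto (fun N => ‖S.Ψ N φ‖) atTop (𝓝 ‖(φ : Hinf)‖) := by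
  have h := (Real.continuous_sqrt.tendsto _).comp (S.tendsto_inner φ)
  simpa [Function.comp_def, real_inner_self_eq_norm_sq] using h

theorem tendsto_inner_Ψ (S : ConvergingHilbertSpaces H Hinf) (φ ψ : S.C) :
    Tendsto (fun N => inner ℝ (S.Ψ N φ) (S.Ψ N ψ)) atTop (𝓝 (inner ℝ (φ : Hinf) (ψ : Hinf))) := by
  have h := (((S.tendsto_inner (φ + ψ)).sub (S.tendsto_inner φ)).sub
    (S.tendsto_inner ψ)).div_const 2
  have e : ∀ {E : Type _} [NormedAddCommGroup E] [InnerProductSpace ℝ E] (a b : E),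
      (inner ℝ (a + b) (a + b) - inner ℝ a a - inner ℝ b b) / 2 = inner ℝ a b := by
    intro E _ _ a b
    rw [real_inner_add_add_self]
    ring
  have e' : (inner ℝ ((φ : Hinf) + ψ) ((φ : Hinf) + ψ) - inner ℝ (φ : Hinf) (φ : Hinf)
      - inner ℝ (ψ : Hinf) (ψ : Hinf)) / 2 = inner ℝ (φ : Hinf) (ψ : Hinf) := by
    rw [real_inner_add_add_self]
    ring
  rw [Submodule.coe_add, e'] at h
  refine h.congr fun N => ?_
  rw [map_add, e]

theorem stronglyConverges_Ψ (S : ConvergingHilbertSpaces H Hinf) (φ : S.C) :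
    S.StronglyConverges (fun N => S.Ψ N φ) φ :=
  ⟨fun ψ => S.tendsto_inner_Ψ φ ψ, S.tendsto_norm_Ψ φ⟩

theorem exists_C_norm_sub_lt (S : ConvergingHilbertSpaces H Hinf) (u : Hinf) {ε : ℝ} (hε : 0 < ε) :
    ∃ φ : S.C, ‖u - φ‖ < ε := by
  obtain ⟨φ, hφ, h⟩ := Metric.mem_closure_iff.1 (S.dense_C u) ε hε
  exact ⟨⟨φ, hφ⟩, by simpa [dist_eq_norm] using h⟩

/-- Expanding the square leaves only norms and the pairing with `Ψ N φ`, exactly the data in the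
definition of strong convergence. All approximation arguments use strong convergence in this form.
-/
theorem StronglyConverges.tendsto_norm_sub_Ψ {u : ∀ N, H N} {uinf : Hinf}
    (h : S.StronglyConverges u uinf) (φ : S.C) :
    Tendsto (fun N => ‖u N - S.Ψ N φ‖) atTop (𝓝 ‖uinf - φ‖) := by
  have h1 := (((h.2.pow 2).sub ((h.1 φ).const_mul 2)).add ((S.tendsto_norm_Ψ φ).pow 2)).sqrt
  rw [← norm_sub_sq_real, Real.sqrt_sq (norm_nonneg _)] at h1
  refine h1.congr fun N => ?_
  rw [← norm_sub_sq_real, Real.sqrt_sq (norm_nonneg _)]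

theorem StronglyConverges.eventually_norm_le {u : ∀ N, H N} {uinf : Hinf}
    (h : S.StronglyConverges u uinf) : ∀ᶠ N in atTop, ‖u N‖ ≤ ‖uinf‖ + 1 :=
  h.2.eventually_le_const (by linarith)

/-- A bounded section that converges weakly against `Ψ N φ`, `φ ∈ C`, converges weakly. -/
theorem weaklyConverges_of_bounded {u : ∀ N, H N} {uinf : Hinf} {M : ℝ}
    (hM : ∀ᶠ N in atTop, ‖u N‖ ≤ M)
    (h : ∀ φ : S.C, Tendsto (fun N => inner ℝ (u N) (S.Ψ N φ)) atTop
      (𝓝 (inner ℝ uinf (φ : Hinf)))) : S.WeaklyConverges u uinf := by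
  intro v vinf hv
  refine tendsto_of_approx fun ε hε => ?_
  -- A single constant dominates both the section and its limit, and is positive whatever the sign
  -- of `M`.
  set K := |M| + ‖uinf‖ + 1 with hK
  have hK0 : 0 < K := by positivity
  obtain ⟨φ, hφ⟩ := S.exists_C_norm_sub_lt vinf (div_pos hε hK0)
  refine ⟨_, _, h φ, ?_, ?_⟩
  · rw [← inner_sub_right]
    refine (abs_real_inner_le_norm _ _).trans ?_
    rw [norm_sub_rev]
    calc ‖uinf‖ * ‖vinf - φ‖ ≤ K * (ε / K) := by
          gcongr
          rw [hK]; linarith [abs_nonneg M]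
      _ = ε := by field_simp
  · filter_upwards [hM, (hv.tendsto_norm_sub_Ψ φ).eventually_lt_const hφ] with N h1 h2
    rw [← inner_sub_right]
    refine (abs_real_inner_le_norm _ _).trans ?_
    calc ‖u N‖ * ‖v N - S.Ψ N φ‖ ≤ K * (ε / K) := by
          gcongr
          rw [hK]; linarith [le_abs_self M, norm_nonneg uinf]
      _ = ε := by field_simp

theorem StronglyConverges.weaklyConverges {u : ∀ N, H N} {uinf : Hinf}
    (h : S.StronglyConverges u uinf) : S.WeaklyConverges u uinf :=
  weaklyConverges_of_bounded h.eventually_norm_le h.1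

theorem StronglyConverges.inner {u v : ∀ N, H N} {uinf vinf : Hinf}
    (hu : S.StronglyConverges u uinf) (hv : S.StronglyConverges v vinf) :
    Tendsto (fun N => inner ℝ (u N) (v N)) atTop (𝓝 (inner ℝ uinf vinf)) :=
  hu.weaklyConverges v vinf hv

theorem StronglyConverges.add {u v : ∀ N, H N} {uinf vinf : Hinf}
    (hu : S.StronglyConverges u uinf) (hv : S.StronglyConverges v vinf) :
    S.StronglyConverges (fun N => u N + v N) (uinf + vinf) := by
  refine ⟨fun φ => ?_, ?_⟩
  · simpa only [inner_add_left] using (hu.1 φ).add (hv.1 φ)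
  · have h1 := (((hu.2.pow 2).add ((hu.inner hv).const_mul 2)).add (hv.2.pow 2)).sqrt
    rw [← norm_add_sq_real, Real.sqrt_sq (norm_nonneg _)] at h1
    refine h1.congr fun N => ?_
    rw [← norm_add_sq_real, Real.sqrt_sq (norm_nonneg _)]

theorem StronglyConverges.smul {u : ∀ N, H N} {uinf : Hinf} (c : ℝ)
    (hu : S.StronglyConverges u uinf) : S.StronglyConverges (fun N => c • u N) (c • uinf) := by
  refine ⟨fun φ => ?_, ?_⟩
  · simpa only [real_inner_smul_left] using (hu.1 φ).const_mul c
  · simpa only [norm_smul] using hu.2.const_mul ‖c‖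

theorem StronglyConverges.sub {u v : ∀ N, H N} {uinf vinf : Hinf}
    (hu : S.StronglyConverges u uinf) (hv : S.StronglyConverges v vinf) :
    S.StronglyConverges (fun N => u N - v N) (uinf - vinf) := by
  simpa [sub_eq_add_neg] using hu.add (hv.smul (-1))

theorem StronglyConverges.tendsto_norm_sub {u v : ∀ N, H N} {uinf vinf : Hinf}
    (hu : S.StronglyConverges u uinf) (hv : S.StronglyConverges v vinf) :
    Tendsto (fun N => ‖u N - v N‖) atTop (𝓝 ‖uinf - vinf‖) := (hu.sub hv).2

/-- Strong convergence may be verified up to arbitrarily small errors. -/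
theorem stronglyConverges_of_approx {u : ∀ N, H N} {uinf : Hinf}
    (h : ∀ ε : ℝ, 0 < ε → ∃ (v : ∀ N, H N) (vinf : Hinf), S.StronglyConverges v vinf ∧
      ‖uinf - vinf‖ ≤ ε ∧ ∀ᶠ N in atTop, ‖u N - v N‖ ≤ ε) : S.StronglyConverges u uinf := by
  refine ⟨fun φ => tendsto_of_approx fun ε hε => ?_, tendsto_of_approx fun ε hε => ?_⟩
  · set K := ‖(φ : Hinf)‖ + 1 with hK
    have hK0 : 0 < K := by positivity
    obtain ⟨v, vinf, hv, h1, h2⟩ := h (ε / K) (div_pos hε hK0)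
    refine ⟨_, _, hv.1 φ, ?_, ?_⟩
    · rw [← inner_sub_left]
      refine (abs_real_inner_le_norm _ _).trans ?_
      rw [norm_sub_rev]
      calc ‖uinf - vinf‖ * ‖(φ : Hinf)‖ ≤ (ε / K) * K := by
            gcongr
            rw [hK]; linarith
        _ = ε := by field_simp
    · filter_upwards [h2, (S.stronglyConverges_Ψ φ).eventually_norm_le] with N h3 h4
      rw [← inner_sub_left]
      refine (abs_real_inner_le_norm _ _).trans ?_
      calc ‖u N - v N‖ * ‖S.Ψ N φ‖ ≤ (ε / K) * K := by gcongr
        _ = ε := by field_simp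
  · obtain ⟨v, vinf, hv, h1, h2⟩ := h ε hε
    refine ⟨_, _, hv.2, ?_, ?_⟩
    · rw [abs_sub_comm]
      exact (abs_norm_sub_norm_le _ _).trans h1
    · filter_upwards [h2] with N h3
      exact (abs_norm_sub_norm_le _ _).trans h3

theorem StronglyConverges.of_tendsto_norm_sub {u v : ∀ N, H N} {vinf : Hinf}
    (hv : S.StronglyConverges v vinf) (h : Tendsto (fun N => ‖u N - v N‖) atTop (𝓝 0)) :
    S.StronglyConverges u vinf :=
  stronglyConverges_of_approx fun ε hε =>
    ⟨v, vinf, hv, by simpa using hε.le, h.eventually_le_const hε⟩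

/-- A diagonal sequence of strongly convergent sections converges strongly, and real quantities
attached to the sections converge along it. -/
theorem exists_diagonal {w : ℕ → ∀ N, H N} {v : ℕ → Hinf} {u : Hinf}
    {e : ℕ → ℕ → ℝ} {f : ℕ → ℝ} {r : ℝ}
    (hw : ∀ m, S.StronglyConverges (w m) (v m)) (hv : Tendsto v atTop (𝓝 u))
    (he : ∀ m, Tendsto (e m) atTop (𝓝 (f m))) (hf : Tendsto f atTop (𝓝 r)) :
    ∃ m : ℕ → ℕ, S.StronglyConverges (fun N => w (m N) N) u ∧
      Tendsto (fun N => e (m N) N) atTop (𝓝 r) := by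
  -- At stage `m` the section `w m` is compared with all earlier sections `w j` at once. For fixed
  -- `j` the diagonal then stays close to `w j` as soon as `m N ≥ j`, so no uniformity in `m` is
  -- required.
  have hP : ∀ m, ∀ᶠ N in atTop, (∀ j ∈ Finset.range (m + 1),
      ‖w m N - w j N‖ ≤ ‖v m - v j‖ + 1 / ((m : ℝ) + 1)) ∧
      |e m N - f m| ≤ 1 / ((m : ℝ) + 1) := by
    intro m
    have hm : (0 : ℝ) < 1 / ((m : ℝ) + 1) := by positivity
    refine Filter.Eventually.and ?_ ?_
    · rw [Filter.eventually_all_finset]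
      intro j _
      exact ((hw m).tendsto_norm_sub (hw j)).eventually_le_const (by linarith)
    · filter_upwards [(Metric.tendsto_nhds.1 (he m)) _ hm] with N hN
      exact hN.le
  obtain ⟨m, hm, hmP⟩ := exists_tendsto_atTop_diagonal hP
  have h0 := (tendsto_one_div_add_atTop_nhds_zero_nat (𝕜 := ℝ)).comp hm
  refine ⟨m, stronglyConverges_of_approx fun ε hε => ?_, ?_⟩
  · have hd : ∀ᶠ j in atTop, ‖v j - u‖ < ε / 3 := by
      simpa [dist_eq_norm] using (Metric.tendsto_nhds.1 hv) (ε / 3) (by positivity)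
    obtain ⟨j, hj⟩ := hd.exists
    refine ⟨w j, v j, hw j, by rw [norm_sub_rev]; linarith, ?_⟩
    filter_upwards [hmP, hm.eventually hd, hm.eventually_ge_atTop j,
      h0.eventually_lt_const (show (0 : ℝ) < ε / 3 by positivity)] with N h1 h2 h3 h4
    have h5 := h1.1 j (Finset.mem_range.2 (by omega))
    have h6 : ‖v (m N) - v j‖ ≤ ‖v (m N) - u‖ + ‖v j - u‖ := by
      rw [norm_sub_rev (v j)]
      exact norm_sub_le_norm_sub_add_norm_sub _ _ _
    simp only [Function.comp_apply] at h4
    linarith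
  · have h1 : Tendsto (fun N => e (m N) N - f (m N)) atTop (𝓝 0) := by
      refine squeeze_zero_norm' ?_ h0
      filter_upwards [hmP] with N hN
      exact hN.2
    simpa using h1.add (hf.comp hm)

/-- Density of `C` gives approximants `φ m`, and a diagonal of the sections `Ψ N (φ m)` does the
rest. Weak convergence can therefore be tested against any vector of the limit space. -/
theorem exists_stronglyConverges (S : ConvergingHilbertSpaces H Hinf) (u : Hinf) :
    ∃ w : ∀ N, H N, S.StronglyConverges w u := by
  choose φ hφ using fun m : ℕ => S.exists_C_norm_sub_lt u
    (show (0 : ℝ) < 1 / ((m : ℝ) + 1) by positivity)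
  have hv : Tendsto (fun m => (φ m : Hinf)) atTop (𝓝 u) := by
    rw [tendsto_iff_norm_sub_tendsto_zero]
    refine squeeze_zero (fun _ => norm_nonneg _) (fun m => ?_)
      (tendsto_one_div_add_atTop_nhds_zero_nat (𝕜 := ℝ))
    rw [norm_sub_rev]
    exact (hφ m).le
  obtain ⟨m, hm, -⟩ := exists_diagonal (e := fun _ _ => 0) (f := fun _ => 0) (r := 0)
    (fun m => S.stronglyConverges_Ψ (φ m)) hv (fun _ => tendsto_const_nhds) tendsto_const_nhds
  exact ⟨_, hm⟩

/-- If `w N` converges strongly to `uinf`, then `‖u N‖² ≥ 2⟨u N, w N⟩ - ‖w N‖²`, and the right side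
tends to `‖uinf‖²`. This is lower semicontinuity of the norm, obtained without any bound on the
section. -/
theorem WeaklyConverges.eventually_lt_norm_sq {u : ∀ N, H N} {uinf : Hinf}
    (h : S.WeaklyConverges u uinf) {c : ℝ} (hc : c < ‖uinf‖ ^ 2) :
    ∀ᶠ N in atTop, c < ‖u N‖ ^ 2 := by
  obtain ⟨w, hw⟩ := S.exists_stronglyConverges uinf
  have h1 := ((h w uinf hw).const_mul 2).sub (hw.2.pow 2)
  have h2 : 2 * inner ℝ uinf uinf - ‖uinf‖ ^ 2 = ‖uinf‖ ^ 2 := by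
    rw [real_inner_self_eq_norm_sq]
    ring
  rw [h2] at h1
  filter_upwards [h1.eventually_const_lt hc] with N hN
  have h3 := norm_sub_sq_real (u N) (w N)
  nlinarith [sq_nonneg ‖u N - w N‖]

theorem StronglyConverges.subseq {u : ∀ N, H N} {uinf : Hinf} (h : S.StronglyConverges u uinf)
    (n : ℕ → ℕ) (hn : StrictMono n) :
    (S.subseq n hn).StronglyConverges (fun k => u (n k)) uinf :=
  ⟨fun φ => (h.1 φ).comp hn.tendsto_atTop, h.2.comp hn.tendsto_atTop⟩

/-- Weak convergence along a subsequence extends to a weakly convergent section, with a strongly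
convergent section on the complementary indices. -/
theorem weaklyConverges_ite {u w : ∀ N, H N} {uinf : Hinf} {n : ℕ → ℕ} {hn : StrictMono n}
    [DecidablePred (· ∈ Set.range n)]
    (hu : (S.subseq n hn).WeaklyConverges (fun k => u (n k)) uinf)
    (hw : S.StronglyConverges w uinf) :
    S.WeaklyConverges (fun N => if N ∈ Set.range n then u N else w N) uinf := by
  intro v vinf hv
  have h1 := hu _ _ (hv.subseq n hn)
  have h2 := hw.inner hv
  rw [Metric.tendsto_atTop] at h1 h2 ⊢
  intro ε hε
  obtain ⟨a, ha⟩ := h1 ε hε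
  obtain ⟨b, hb⟩ := h2 ε hε
  refine ⟨max (n a) b, fun N hN => ?_⟩
  by_cases hr : N ∈ Set.range n
  · obtain ⟨k, rfl⟩ := hr
    simp only [Set.mem_range_self, if_true]
    exact ha k (hn.le_iff_le.1 (le_of_max_le_left hN))
  · simp only [hr, if_false]
    exact hb N (le_of_max_le_right hN)

/-- Bounded sections are weakly sequentially relatively compact. -/
theorem exists_subseq_weaklyConverges [CompleteSpace Hinf] [TopologicalSpace.SeparableSpace Hinf]
    (S : ConvergingHilbertSpaces H Hinf) {u : ∀ N, H N} {M : ℝ} (hM : ∀ N, ‖u N‖ ≤ M) :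
    ∃ (n : ℕ → ℕ) (hn : StrictMono n) (uinf : Hinf),
      (S.subseq n hn).WeaklyConverges (fun k => u (n k)) uinf := by
  have hM0 : 0 ≤ M := (norm_nonneg _).trans (hM 0)
  have : Nonempty S.C := ⟨0⟩
  have hbd : ∀ φ : S.C, ∃ B, ∀ N, ‖S.Ψ N φ‖ ≤ B := fun φ => by
    obtain ⟨B, hB⟩ := (S.tendsto_norm_Ψ φ).bddAbove_range
    exact ⟨B, fun N => hB ⟨N, rfl⟩⟩
  choose B hB using hbd
  -- The pairings with a dense sequence of `C` lie in a countable product of compact intervals;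
  -- compactness of the product replaces a diagonal extraction.
  have hc : IsCompact (Set.univ.pi fun j : ℕ =>
      Set.Icc (-(M * B (TopologicalSpace.denseSeq S.C j)))
        (M * B (TopologicalSpace.denseSeq S.C j))) :=
    isCompact_univ_pi fun j => isCompact_Icc
  obtain ⟨a, -, n, hn, ha⟩ := hc.tendsto_subseq
    (x := fun N j => inner ℝ (u N) (S.Ψ N (TopologicalSpace.denseSeq S.C j))) fun N j _ => by
      change inner ℝ (u N) (S.Ψ N (TopologicalSpace.denseSeq S.C j)) ∈ Set.Icc _ _
      rw [Set.mem_Icc, ← abs_le]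
      refine (abs_real_inner_le_norm _ _).trans ?_
      gcongr
      · exact hM N
      · exact hB _ N
  rw [tendsto_pi_nhds] at ha
  -- Boundedness of the section carries convergence from the dense sequence to all of `C`.
  have hlim : ∀ φ : S.C, ∃ l, Tendsto (fun k => inner ℝ (u (n k)) (S.Ψ (n k) φ)) atTop (𝓝 l) := by
    intro φ
    refine cauchySeq_tendsto_of_complete ?_
    rw [Metric.cauchySeq_iff]
    intro ε hε
    obtain ⟨j, hj⟩ := (TopologicalSpace.denseRange_denseSeq S.C).exists_dist_lt φ
      (show 0 < ε / (3 * (M + 1)) by positivity)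
    set ψ := TopologicalSpace.denseSeq S.C j
    have hj' : ‖((φ - ψ : S.C) : Hinf)‖ < ε / (3 * (M + 1)) := by
      simpa [dist_eq_norm] using hj
    obtain ⟨k₁, hk₁⟩ := Metric.cauchySeq_iff.1 (ha j).cauchySeq (ε / 3) (by positivity)
    obtain ⟨k₂, hk₂⟩ := eventually_atTop.1
      (((S.tendsto_norm_Ψ (φ - ψ)).comp hn.tendsto_atTop).eventually_lt_const hj')
    have hd : ∀ k ≥ k₂, |inner ℝ (u (n k)) (S.Ψ (n k) φ) - inner ℝ (u (n k)) (S.Ψ (n k) ψ)|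
        < ε / 3 := by
      intro k hk
      rw [← inner_sub_right, ← map_sub]
      refine (abs_real_inner_le_norm _ _).trans_lt ?_
      have h1 := hk₂ k hk
      simp only [Function.comp_apply] at h1
      calc _ ≤ (M + 1) * ‖S.Ψ (n k) (φ - ψ)‖ := by gcongr; linarith [hM (n k)]
        _ < (M + 1) * (ε / (3 * (M + 1))) := by gcongr
        _ = ε / 3 := by field_simp
    refine ⟨max k₁ k₂, fun p hp q hq => ?_⟩
    have h1 := hk₁ p (le_of_max_le_left hp) q (le_of_max_le_left hq)
    have h2 := hd p (le_of_max_le_right hp)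
    have h3 := hd q (le_of_max_le_right hq)
    simp only [Real.dist_eq, Function.comp_apply] at h1 ⊢
    rw [abs_lt] at *
    constructor <;> linarith [h1.1, h1.2, h2.1, h2.2, h3.1, h3.2]
  choose l hl using hlim
  -- The limits of the pairings form a bounded functional on `C`; Hahn–Banach extends it and Riesz
  -- represents it by the weak limit.
  let ℓ : S.C →ₗ[ℝ] ℝ :=
    { toFun := l
      map_add' := fun φ ψ => tendsto_nhds_unique (hl (φ + ψ)) (by
        simpa only [map_add, inner_add_right] using (hl φ).add (hl ψ))
      map_smul' := fun c φ => tendsto_nhds_unique (hl (c • φ)) (by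
        simpa only [map_smul, real_inner_smul_right, RingHom.id_apply, smul_eq_mul] using (hl φ).const_mul c) }
  have hℓ : ∀ φ : S.C, ‖ℓ φ‖ ≤ M * ‖φ‖ := fun φ =>
    le_of_tendsto_of_tendsto' (hl φ).norm
      (((S.tendsto_norm_Ψ φ).comp hn.tendsto_atTop).const_mul M) fun k => by
        refine (abs_real_inner_le_norm _ _).trans ?_
        exact mul_le_mul_of_nonneg_right (hM _) (norm_nonneg _)
  let L : S.C →L[ℝ] ℝ := ℓ.mkContinuous M hℓ
  obtain ⟨L', hL', -⟩ := exists_extension_norm_eq S.C L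
  refine ⟨n, hn, (InnerProductSpace.toDual ℝ Hinf).symm L',
    weaklyConverges_of_bounded (M := M) (Eventually.of_forall fun k => hM (n k)) fun φ => ?_⟩
  have h2 : inner ℝ ((InnerProductSpace.toDual ℝ Hinf).symm L') (φ : Hinf) = l φ := by
    rw [InnerProductSpace.toDual_symm_apply]
    exact hL' φ
  rw [h2]
  exact hl φ

end ConvergingHilbertSpaces

/-! ### The closed form, its resolvent and the Yosida approximation -/

namespace ContractionResolvent

variable {H : Type*} [NormedAddCommGroup H] [InnerProductSpace ℝ H] (R : ContractionResolvent H)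

theorem norm_G_le {α : ℝ} (hα : 0 < α) (u : H) : ‖R.G α u‖ ≤ α⁻¹ * ‖u‖ := by
  have h := (α • R.G α).le_of_opNorm_le (R.contraction α hα) u
  rw [smul_apply, norm_smul, one_mul, Real.norm_of_nonneg hα.le] at h
  rwa [inv_mul_eq_div, le_div_iff₀' hα]

theorem G_mem_domain {α : ℝ} (hα : 0 < α) (u : H) : R.G α u ∈ R.generator.domain := by
  rw [R.resolvent_apply hα one_pos]
  exact ⟨_, rfl⟩

theorem generator_G {α : ℝ} (hα : 0 < α) (u : H) (h : R.G α u ∈ R.generator.domain) :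
    R.generator ⟨R.G α u, h⟩ = α • R.G α u - u := by
  have e := R.resolvent_apply hα one_pos u
  have : (⟨R.G α u, h⟩ : R.generator.domain) = ⟨R.G 1 (u + (1 - α) • R.G α u), e ▸ h⟩ :=
    Subtype.ext e
  rw [this, R.generator_G_one, ← e]
  module

theorem preForm_G (x : R.generator.domain) {α : ℝ} (hα : 0 < α) (u : H) :
    R.preForm x ⟨R.G α u, R.G_mem_domain hα u⟩ = inner ℝ (x : H) (u - α • R.G α u) := by
  rw [preForm_apply, R.generator_G hα, neg_sub]

theorem form_nonneg (u : R.formDomain) : 0 ≤ R.form u u :=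
  ge_of_tendsto' (R.tendsto_formValue (R.isApprox_approxSeq u) (R.isApprox_approxSeq u))
    fun _ => R.preForm_nonneg _

theorem form_symm (u v : R.formDomain) : R.form u v = R.form v u := R.formValue_symm u v

/-- On the generator domain this is the formula for `Δ (G α u)`. The right side is norm continuous
in `v`, so it survives the closure of the form. -/
theorem form_G (v : R.formDomain) {α : ℝ} (hα : 0 < α) (u : H) :
    R.form v ⟨R.G α u, R.G_mem_formDomain hα u⟩ = inner ℝ (v : H) (u - α • R.G α u) := by
  have hv := R.isApprox_approxSeq v
  refine tendsto_nhds_unique (R.tendsto_formValue (v := ⟨R.G α u, R.G_mem_formDomain hα u⟩) hv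
    (R.isApprox_const ⟨R.G α u, R.G_mem_domain hα u⟩)) ?_
  refine (hv.tendsto.inner tendsto_const_nhds).congr fun n => ?_
  rw [R.preForm_G _ hα]

theorem formShift_G {α : ℝ} (hα : 0 < α) (u : H) :
    R.formShift α ⟨R.G α u, R.G_mem_formDomain hα u⟩ ⟨R.G α u, R.G_mem_formDomain hα u⟩
      = inner ℝ (R.G α u) u := by
  rw [formShift, R.form_G _ hα, inner_sub_right, inner_smul_right]
  ring

theorem formShift_nonneg {α : ℝ} (hα : 0 ≤ α) (u : R.formDomain) : 0 ≤ R.formShift α u u := by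
  have := R.form_nonneg u
  rw [formShift, real_inner_self_eq_norm_sq]
  positivity

theorem mul_norm_sq_le_formShift (α : ℝ) (u : R.formDomain) :
    α * ‖(u : H)‖ ^ 2 ≤ R.formShift α u u := by
  rw [formShift, real_inner_self_eq_norm_sq]
  linarith [R.form_nonneg u]

theorem formShift_le {α : ℝ} (hα : 0 ≤ α) (u : R.formDomain) :
    R.formShift α u u ≤ (1 + α) * R.formShift 1 u u := by
  rw [formShift, formShift, real_inner_self_eq_norm_sq]
  nlinarith [R.form_nonneg u, mul_nonneg hα (R.form_nonneg u), sq_nonneg ‖(u : H)‖]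

/-- The resolvent `G α u` is the minimizer of `v ↦ ℰ_α(v, v) - 2 ⟨v, u⟩`. -/
theorem formShift_sub_G (v : R.formDomain) {α : ℝ} (hα : 0 < α) (u : H) :
    R.formShift α (v - ⟨R.G α u, R.G_mem_formDomain hα u⟩)
      (v - ⟨R.G α u, R.G_mem_formDomain hα u⟩)
      = R.formShift α v v - 2 * inner ℝ (v : H) u + inner ℝ (R.G α u) u := by
  have h1 := R.form_G v hα u
  have h2 := R.formShift_G hα u
  have h3 := R.form_symm ⟨R.G α u, R.G_mem_formDomain hα u⟩ v
  have h4 := real_inner_comm (v : H) (R.G α u)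
  simp only [formShift, map_sub, LinearMap.sub_apply, Submodule.coe_sub, inner_sub_left,
    inner_sub_right, inner_smul_right] at *
  linear_combination -2 * h1 + h2 - h3 - α * h4

theorem inner_G_nonneg {α : ℝ} (hα : 0 < α) (u : H) : 0 ≤ inner ℝ (R.G α u) u := by
  rw [← R.formShift_G hα]
  exact R.formShift_nonneg hα.le _

theorem energy_eq {u : H} (h : u ∈ R.formDomain) :
    R.energy u = ((R.form ⟨u, h⟩ ⟨u, h⟩ : ℝ) : EReal) := by rw [energy, dif_pos h]

theorem energy_G {α : ℝ} (hα : 0 < α) (u : H) :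
    R.energy (R.G α u) = ((inner ℝ (R.G α u) u - α * ‖R.G α u‖ ^ 2 : ℝ) : EReal) := by
  rw [R.energy_eq (R.G_mem_formDomain hα u), R.form_G _ hα, inner_sub_right, inner_smul_right,
    real_inner_self_eq_norm_sq]

/-- For `β ≤ γ` the increment is a nonnegative multiple of the positive operator `G γ` applied to `u
- β G β u`; this sign makes the Yosida energies monotone. -/
theorem smul_G_sub_smul_G {β γ : ℝ} (hβ : 0 < β) (hγ : 0 < γ) (u : H) :
    γ • R.G γ u - β • R.G β u = (γ - β) • R.G γ (u - β • R.G β u) := by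
  have h := R.resolvent_apply hβ hγ u
  rw [map_add, map_smul] at h
  rw [map_sub, map_smul]
  have h' : (γ - β) • R.G γ (R.G β u) = R.G β u - R.G γ u := by
    rw [eq_sub_iff_add_eq, add_comm]
    exact h.symm
  rw [smul_sub, smul_comm (γ - β) β, h']
  module

/-- The approximation `β G β u` of `u`, as an element of the domain of the generator. -/
noncomputable def yosida {β : ℝ} (hβ : 0 < β) (u : H) : R.generator.domain :=
  β • ⟨R.G β u, R.G_mem_domain hβ u⟩

theorem coe_yosida {β : ℝ} (hβ : 0 < β) (u : H) : (R.yosida hβ u : H) = β • R.G β u := rfl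

theorem preForm_yosida (x : R.generator.domain) {β : ℝ} (hβ : 0 < β) (u : H) :
    R.preForm x (R.yosida hβ u) = β * inner ℝ (x : H) (u - β • R.G β u) := by
  rw [yosida, map_smul, R.preForm_G _ hβ, smul_eq_mul]

/-- Write `y_β` for `β G β u`. Then `ℰ(y_γ - y_β, y_β) = β(γ - β)⟨G γ z, z⟩ ≥ 0` with `z = u - β G β
u`, and twice this quantity is the gap in the inequality. Increments of the energies thus control
distances in the form. -/
theorem preForm_yosida_sub_le {β γ : ℝ} (hβ : 0 < β) (hγ : 0 < γ) (h : β ≤ γ) (u : H) :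
    R.preForm (R.yosida hγ u - R.yosida hβ u) (R.yosida hγ u - R.yosida hβ u)
      ≤ R.preForm (R.yosida hγ u) (R.yosida hγ u)
        - R.preForm (R.yosida hβ u) (R.yosida hβ u) := by
  have h1 : 0 ≤ R.preForm (R.yosida hγ u - R.yosida hβ u) (R.yosida hβ u) := by
    rw [preForm_yosida, Submodule.coe_sub, coe_yosida, coe_yosida, R.smul_G_sub_smul_G hβ hγ,
      inner_smul_left]
    have := R.inner_G_nonneg hγ (u - β • R.G β u)
    have h2 : 0 ≤ γ - β := by linarith
    simp only [conj_trivial]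
    positivity
  have h2 := R.preForm_symm (R.yosida hγ u) (R.yosida hβ u)
  simp only [map_sub, LinearMap.sub_apply] at h1 ⊢
  linarith

theorem preForm_yosida_self_le {β : ℝ} (hβ : 0 < β) (u : H) :
    R.preForm (R.yosida hβ u) (R.yosida hβ u) ≤ β * inner ℝ u (u - β • R.G β u) := by
  rw [preForm_yosida, coe_yosida]
  have h : 0 ≤ inner ℝ (u - β • R.G β u) (u - β • R.G β u) := real_inner_self_nonneg
  rw [inner_sub_left] at h
  gcongr
  linarith

/-- The energies of the approximations increase and are bounded by `M`, so they converge. Their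
increments bound the form distances, so the approximations are Cauchy. The parameters `n + 1` stay
positive. -/
theorem isApprox_yosida {u : H} {M : ℝ}
    (hM : ∀ n : ℕ, ((n : ℝ) + 1) * inner ℝ u (u - ((n : ℝ) + 1) • R.G ((n : ℝ) + 1) u) ≤ M) :
    R.IsApprox (fun n : ℕ => R.yosida (Nat.cast_add_one_pos (α := ℝ) n) u) u := by
  set w := fun n : ℕ => R.yosida (Nat.cast_add_one_pos (α := ℝ) n) u with hw
  have hle : ∀ m n, m ≤ n → R.preForm (w n - w m) (w n - w m)
      ≤ R.preForm (w n) (w n) - R.preForm (w m) (w m) := fun m n hmn =>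
    R.preForm_yosida_sub_le _ _ (by gcongr) u
  refine ⟨?_, fun ε hε => ?_⟩
  · exact (R.strongly_continuous u).comp
      (tendsto_atTop_add_const_right _ 1 tendsto_natCast_atTop_atTop)
  · have hmono : Monotone fun n => R.preForm (w n) (w n) := fun m n hmn => by
      have h1 := hle m n hmn
      have h2 := R.preForm_nonneg (w n - w m)
      change R.preForm (w m) (w m) ≤ R.preForm (w n) (w n)
      linarith
    have hlim := tendsto_atTop_ciSup hmono ⟨M, by
      rintro _ ⟨n, rfl⟩
      exact (R.preForm_yosida_self_le _ u).trans (hM n)⟩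
    obtain ⟨a, ha⟩ := Metric.cauchySeq_iff.1 hlim.cauchySeq ε hε
    refine ⟨a, fun m hm n hn => ?_⟩
    have hd := ha m hm n hn
    rw [Real.dist_eq] at hd
    rcases le_total m n with h | h
    · have h1 := hle m n h
      have h2 : R.preForm (w m - w n) (w m - w n) = R.preForm (w n - w m) (w n - w m) := by
        rw [← neg_sub (w n) (w m)]
        simp only [map_neg, LinearMap.neg_apply, neg_neg]
      rw [abs_lt] at hd
      linarith [hd.1]
    · have h1 := hle n m h
      rw [abs_lt] at hd
      linarith [hd.2]

/-- With `g = G β u`, positivity of `ℰ` at `u - βg` gives `ℰ(u, u) ≥ 2βℰ(u, g) - β²ℰ(g, g)`, while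
`‖u - βg‖² ≥ 0` reads `βℰ(g, g) ≤ ℰ(u, g)`. -/
theorem mul_inner_sub_smul_G_le_form (u : R.formDomain) {β : ℝ} (hβ : 0 < β) :
    β * inner ℝ (u : H) (u - β • R.G β u) ≤ R.form u u := by
  set g : R.formDomain := ⟨R.G β u, R.G_mem_formDomain hβ u⟩ with hg
  have h0 := R.form_nonneg (u - β • g)
  have h1 : R.form u g = inner ℝ (u : H) (u - β • R.G β u) := R.form_G u hβ u
  have h2 : R.form g g = inner ℝ (R.G β u) (u - β • R.G β u) := R.form_G g hβ u
  have h3 := R.form_symm u g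
  have h4 : 0 ≤ inner ℝ ((u : H) - β • R.G β u) (u - β • R.G β u) := real_inner_self_nonneg
  rw [inner_sub_left, inner_smul_left, ← h1, ← h2] at h4
  simp only [map_sub, map_smul, LinearMap.sub_apply, LinearMap.smul_apply, smul_eq_mul,
    conj_trivial] at h0 h4
  rw [← h1]
  nlinarith

theorem isApprox_yosida_of_mem (u : R.formDomain) :
    R.IsApprox (fun n : ℕ => R.yosida (Nat.cast_add_one_pos (α := ℝ) n) (u : H)) u :=
  R.isApprox_yosida fun _ => R.mul_inner_sub_smul_G_le_form u (by positivity)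

theorem tendsto_preForm_yosida (u : R.formDomain) :
    Tendsto (fun n : ℕ => R.preForm (R.yosida (Nat.cast_add_one_pos (α := ℝ) n) (u : H))
      (R.yosida (Nat.cast_add_one_pos (α := ℝ) n) (u : H))) atTop (𝓝 (R.form u u)) :=
  R.tendsto_formValue (R.isApprox_yosida_of_mem u) (R.isApprox_yosida_of_mem u)

/-- The energy is the supremum of the approximating energies `β ⟨u, u - β G β u⟩`. -/
theorem energy_le_of_forall {u : H} {M : ℝ}
    (hM : ∀ β : ℝ, 0 < β → β * inner ℝ u (u - β • R.G β u) ≤ M) : R.energy u ≤ M := by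
  have h := R.isApprox_yosida (u := u) (M := M) fun n => hM _ (by positivity)
  have hu : u ∈ R.formDomain := ⟨_, h⟩
  rw [R.energy_eq hu, EReal.coe_le_coe_iff]
  exact le_of_tendsto' (R.tendsto_preForm_yosida ⟨u, hu⟩)
    fun n => (R.preForm_yosida_self_le _ u).trans (hM _ (by positivity))

theorem mul_inner_sub_smul_G_le_energy (u : H) {β : ℝ} (hβ : 0 < β) :
    ((β * inner ℝ u (u - β • R.G β u) : ℝ) : EReal) ≤ R.energy u := by
  by_cases h : u ∈ R.formDomain
  · rw [R.energy_eq h, EReal.coe_le_coe_iff]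
    exact R.mul_inner_sub_smul_G_le_form ⟨u, h⟩ hβ
  · rw [energy, dif_neg h]
    exact le_top

/-- Convexity of the approximating energy `β ⟨u, u - β G β u⟩`. -/
theorem two_mul_inner_sub_le {β : ℝ} (hβ : 0 < β) (u v : H) :
    2 * (β * inner ℝ u (v - β • R.G β v)) - β * inner ℝ v (v - β • R.G β v)
      ≤ β * inner ℝ u (u - β • R.G β u) := by
  -- Since `β G β` is a contraction, the Yosida form is nonnegative at `u - v`; expanding bounds its
  -- value at `u` below by the tangent at `v`.
  have h : 0 ≤ inner ℝ (u - v) ((u - v) - β • R.G β (u - v)) := by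
    have h1 : β * ‖R.G β (u - v)‖ ≤ ‖u - v‖ := by
      have := R.norm_G_le hβ (u - v)
      rwa [inv_mul_eq_div, le_div_iff₀' hβ] at this
    have h2 := real_inner_le_norm (u - v) (R.G β (u - v))
    rw [inner_sub_right, inner_smul_right, real_inner_self_eq_norm_sq]
    nlinarith [norm_nonneg (u - v)]
  have h1 := R.symm β hβ u v
  have h2 := real_inner_comm (R.G β u) v
  have h3 := real_inner_comm u v
  have h5 : 0 ≤ β * inner ℝ (u - v) ((u - v) - β • R.G β (u - v)) := by positivity
  simp only [map_sub, inner_sub_left, inner_sub_right, inner_smul_right, smul_sub] at h5 ⊢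
  rw [← h1, h2, h3] at h5
  rw [← h1]
  linarith

end ContractionResolvent

/-! ### Functional calculus of `G 1` and Stone–Weierstrass -/

section FunctionalCalculus

variable {H : Type*} [NormedAddCommGroup H] [InnerProductSpace ℝ H] [CompleteSpace H]
  {A : H →L[ℝ] H}

theorem unitCalculus_mul (hA : ∀ u v, inner ℝ (A u) v = inner ℝ u (A v))
    (h0 : ∀ u, 0 ≤ inner ℝ (A u) u) (h1 : ∀ u, inner ℝ (A u) u ≤ ‖u‖ ^ 2)
    (f g : C(unitInterval, ℝ)) :
    unitCalculus A (f * g) = unitCalculus A f * unitCalculus A g := by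
  refine denseRange_toContinuousMapOn.induction_on₂
    (p := fun f g => unitCalculus A (f * g) = unitCalculus A f * unitCalculus A g) ?_ ?_ f g
  · exact isClosed_eq (by fun_prop) (by fun_prop)
  · intro p q
    simp only [AlgHom.toLinearMap_apply]
    rw [← map_mul, unitCalculus_polynomial hA h0 h1, unitCalculus_polynomial hA h0 h1,
      unitCalculus_polynomial hA h0 h1, map_mul]

theorem unitCalculus_algebraMap (hA : ∀ u v, inner ℝ (A u) v = inner ℝ u (A v))
    (h0 : ∀ u, 0 ≤ inner ℝ (A u) u) (h1 : ∀ u, inner ℝ (A u) u ≤ ‖u‖ ^ 2) (r : ℝ) :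
    unitCalculus A (algebraMap ℝ C(unitInterval, ℝ) r) = algebraMap ℝ (H →L[ℝ] H) r := by
  have h := unitCalculus_polynomial hA h0 h1 (Polynomial.C r)
  rwa [Polynomial.aeval_C, Polynomial.C_eq_algebraMap, AlgHom.commutes] at h

end FunctionalCalculus

/-- The coordinate function on the unit interval. -/
def unitCoordinate : C(unitInterval, ℝ) := ⟨fun s => s, continuous_subtype_val⟩

namespace ContractionResolvent

variable {H : Type*} [NormedAddCommGroup H] [InnerProductSpace ℝ H] (R : ContractionResolvent H)

theorem inner_G_one_le (u : H) : inner ℝ (R.G 1 u) u ≤ ‖u‖ ^ 2 := by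
  have h := R.norm_G_le one_pos u
  rw [inv_one, one_mul] at h
  calc _ ≤ ‖R.G 1 u‖ * ‖u‖ := real_inner_le_norm _ _
    _ ≤ ‖u‖ * ‖u‖ := by gcongr
    _ = _ := (sq _).symm

variable [CompleteSpace H]

/-- The continuous functional calculus of the operator `G 1`. -/
noncomputable def calculus : C(unitInterval, ℝ) →L[ℝ] (H →L[ℝ] H) := unitCalculus (R.G 1)

theorem calculus_mul (f g : C(unitInterval, ℝ)) :
    R.calculus (f * g) = R.calculus f * R.calculus g :=
  unitCalculus_mul (R.symm 1 one_pos) (R.inner_G_nonneg one_pos) R.inner_G_one_le f g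

theorem calculus_algebraMap (r : ℝ) :
    R.calculus (algebraMap ℝ C(unitInterval, ℝ) r) = algebraMap ℝ (H →L[ℝ] H) r :=
  unitCalculus_algebraMap (R.symm 1 one_pos) (R.inner_G_nonneg one_pos) R.inner_G_one_le r

theorem calculus_unitCoordinate : R.calculus unitCoordinate = R.G 1 := by
  have h := unitCalculus_polynomial (R.symm 1 one_pos) (R.inner_G_nonneg one_pos)
    R.inner_G_one_le Polynomial.X
  rw [Polynomial.aeval_X] at h
  rw [← h, calculus]
  congr 1
  ext s
  simp [unitCoordinate]

theorem norm_calculus_le (f : C(unitInterval, ℝ)) : ‖R.calculus f‖ ≤ ‖f‖ :=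
  norm_unitCalculus_le (R.symm 1 one_pos) (R.inner_G_nonneg one_pos) R.inner_G_one_le f

end ContractionResolvent

namespace ConvergingHilbertSpaces

variable {H : ℕ → Type*} {Hinf : Type*}
  [∀ N, NormedAddCommGroup (H N)] [∀ N, InnerProductSpace ℝ (H N)] [∀ N, CompleteSpace (H N)]
  [NormedAddCommGroup Hinf] [InnerProductSpace ℝ Hinf] [CompleteSpace Hinf]

/-- The functions `f` for which the operators `f (G 1)` converge strongly. -/
def convergentSymbols (S : ConvergingHilbertSpaces H Hinf)
    (R : ∀ N, ContractionResolvent (H N)) (Rinf : ContractionResolvent Hinf) :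
    Subalgebra ℝ C(unitInterval, ℝ) where
  carrier := {f | S.OpStronglyConverges (fun N => (R N).calculus f) (Rinf.calculus f)}
  mul_mem' := by
    intro f g hf hg u uinf hu
    simpa only [ContractionResolvent.calculus_mul, mul_apply_eq_comp] using hf _ _ (hg _ _ hu)
  add_mem' := by
    intro f g hf hg u uinf hu
    simpa only [map_add, add_apply] using (hf _ _ hu).add (hg _ _ hu)
  algebraMap_mem' := by
    intro r u uinf hu
    simp only [ContractionResolvent.calculus_algebraMap]
    exact hu.smul r

/-- The calculus is contractive on every space with the same constant 1. A uniform approximation of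
the symbol therefore gives an error uniform in `N` on an eventually bounded section. -/
theorem isClosed_convergentSymbols (S : ConvergingHilbertSpaces H Hinf)
    (R : ∀ N, ContractionResolvent (H N)) (Rinf : ContractionResolvent Hinf) :
    IsClosed (S.convergentSymbols R Rinf : Set C(unitInterval, ℝ)) := by
  refine isClosed_of_closure_subset fun f hf u uinf hu => ?_
  refine stronglyConverges_of_approx fun ε hε => ?_
  have hK0 : 0 < ‖uinf‖ + 1 := by positivity
  obtain ⟨g, hg, hfg⟩ := Metric.mem_closure_iff.1 hf (ε / (‖uinf‖ + 1)) (by positivity)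
  rw [dist_eq_norm] at hfg
  have key : ∀ {E : Type _} [NormedAddCommGroup E] [InnerProductSpace ℝ E] [CompleteSpace E]
      (Q : ContractionResolvent E) (x : E), ‖x‖ ≤ ‖uinf‖ + 1 →
      ‖Q.calculus f x - Q.calculus g x‖ ≤ ε := by
    intro E _ _ _ Q x hx
    rw [← sub_apply, ← map_sub]
    calc _ ≤ ‖f - g‖ * ‖x‖ := (Q.calculus (f - g)).le_of_opNorm_le (Q.norm_calculus_le _) x
      _ ≤ ε / (‖uinf‖ + 1) * (‖uinf‖ + 1) := by gcongr
      _ = ε := by field_simp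
  have key' : ‖Rinf.calculus f uinf - Rinf.calculus g uinf‖ ≤ ε := by
    rw [← sub_apply, ← map_sub]
    calc _ ≤ ‖f - g‖ * ‖uinf‖ :=
          (Rinf.calculus (f - g)).le_of_opNorm_le (Rinf.norm_calculus_le _) uinf
      _ ≤ ε / (‖uinf‖ + 1) * (‖uinf‖ + 1) := by gcongr; linarith
      _ = ε := by field_simp
  refine ⟨_, _, hg u uinf hu, key', ?_⟩
  filter_upwards [hu.eventually_norm_le] with N hN
  exact key (R N) (u N) hN

/-- Constants belong to the subalgebra and one injective symbol separates points, so
Stone–Weierstrass gives density, and closedness gives the rest. -/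
theorem convergentSymbols_eq_top {S : ConvergingHilbertSpaces H Hinf}
    {R : ∀ N, ContractionResolvent (H N)} {Rinf : ContractionResolvent Hinf}
    {f : C(unitInterval, ℝ)} (hf : f ∈ S.convergentSymbols R Rinf)
    (hinj : Function.Injective f) : S.convergentSymbols R Rinf = ⊤ := by
  have h := ContinuousMap.subalgebra_topologicalClosure_eq_top_of_separatesPoints
    (S.convergentSymbols R Rinf) fun x y hxy => ⟨f, ⟨f, hf, rfl⟩, fun h => hxy (hinj h)⟩
  rw [← h]
  exact SetLike.coe_injective (by
    rw [Subalgebra.topologicalClosure_coe, (S.isClosed_convergentSymbols R Rinf).closure_eq])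

end ConvergingHilbertSpaces

/-! ### Symbols of the semigroup and of `Δ ^ p T t` -/

theorem expSymbol_injective (t : ℝ) (ht : 0 < t) : Function.Injective (expSymbol t ht) := by
  intro x y hxy
  change (if (x : ℝ) = 0 then (0 : ℝ) else _) = if (y : ℝ) = 0 then (0 : ℝ) else _ at hxy
  split_ifs at hxy with hx hy hy
  · exact Subtype.ext (hx.trans hy.symm)
  · exact absurd hxy (Real.exp_pos _).ne
  · exact absurd hxy (Real.exp_pos _).ne'
  · have h := mul_left_cancel₀ ht.ne' (Real.exp_injective hxy)
    have h' : 1 / (x : ℝ) = 1 / (y : ℝ) := by linarith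
    rw [one_div, one_div, inv_inj] at h'
    exact Subtype.ext h'

/-- The function `s ↦ (1 - 1 / s) ^ p * exp (t (1 - 1 / s))` on `[0, 1]`, extended by `0` at
`s = 0`. -/
noncomputable def powExpSymbol (p : ℕ) (t : ℝ) (ht : 0 < t) : C(unitInterval, ℝ) where
  toFun s := if (s : ℝ) = 0 then 0
    else (1 - 1 / (s : ℝ)) ^ p * Real.exp (t * (1 - 1 / (s : ℝ)))
  continuous_toFun := by
    -- With `x = 1/s - 1` the symbol becomes `(-1)^p x^p exp(-t x)`, which vanishes as `x → ∞`.
    have key : Tendsto (fun s : ℝ => (1 - 1 / s) ^ p * Real.exp (t * (1 - 1 / s)))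
        (𝓝[>] 0) (𝓝 0) := by
      have h1 : Tendsto (fun s : ℝ => 1 / s - 1) (𝓝[>] 0) atTop := by
        simp only [one_div, sub_eq_add_neg]
        exact tendsto_atTop_add_const_right _ _ tendsto_inv_nhdsGT_zero
      have h2 : Tendsto (fun x : ℝ => (-1) ^ p * (x ^ p * Real.exp (-t * x))) atTop
          (𝓝 ((-1) ^ p * 0)) := by
        refine Tendsto.const_mul _ ?_
        simpa using tendsto_rpow_mul_exp_neg_mul_atTop_nhds_zero p t ht
      rw [mul_zero] at h2
      refine (h2.comp h1).congr fun s => ?_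
      simp only [Function.comp_apply]
      rw [← mul_assoc, ← mul_pow]
      congr 2 <;> ring
    rw [continuous_iff_continuousAt]
    intro s
    by_cases hs : (s : ℝ) = 0
    · rw [ContinuousAt]
      simp only [hs, if_true]
      rw [Metric.tendsto_nhds]
      intro ε hε
      have h2 := (Metric.tendsto_nhds.1 key) ε hε
      rw [eventually_nhdsWithin_iff] at h2
      have h3 : Tendsto (fun x : unitInterval => (x : ℝ)) (𝓝 s) (𝓝 0) := by
        rw [← hs]
        exact continuous_subtype_val.continuousAt
      filter_upwards [h3.eventually h2] with x hx
      by_cases hx0 : (x : ℝ) = 0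
      · simpa [hx0] using hε
      · rw [if_neg hx0]
        exact hx (lt_of_le_of_ne x.2.1 (Ne.symm hx0))
    · have h3 : ContinuousAt (fun x : unitInterval =>
          (1 - 1 / (x : ℝ)) ^ p * Real.exp (t * (1 - 1 / (x : ℝ)))) s := by
        have : ContinuousAt (fun x : unitInterval => (x : ℝ)) s :=
          continuous_subtype_val.continuousAt
        fun_prop (disch := assumption)
      refine h3.congr ?_
      filter_upwards [continuous_subtype_val.continuousAt.eventually_ne hs] with x hx
      rw [if_neg hx]

theorem powExpSymbol_zero (t : ℝ) (ht : 0 < t) : powExpSymbol 0 t ht = expSymbol t ht := by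
  ext s
  simp [powExpSymbol, expSymbol]

/-- This is `s(1 - (1 - 1/s)) = 1` on symbols. It exhibits the operator with exponent `p` as `G 1`
composed with another one, so its values lie in the domain of `Δ`, and `Δ` raises the exponent by
one. -/
theorem unitCoordinate_mul_powExpSymbol_sub (p : ℕ) (t : ℝ) (ht : 0 < t) :
    unitCoordinate * (powExpSymbol p t ht - powExpSymbol (p + 1) t ht) = powExpSymbol p t ht := by
  ext s
  by_cases hs : (s : ℝ) = 0
  · simp only [powExpSymbol, unitCoordinate, ContinuousMap.mul_apply, ContinuousMap.sub_apply,
      ContinuousMap.coe_mk, hs, if_true, zero_mul]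
  · simp only [powExpSymbol, unitCoordinate, ContinuousMap.mul_apply, ContinuousMap.sub_apply,
      ContinuousMap.coe_mk, hs, if_false]
    have h : (s : ℝ) * (1 / (s : ℝ)) = 1 := by field_simp
    linear_combination (1 - 1 / (s : ℝ)) ^ p * Real.exp (t * (1 - 1 / (s : ℝ))) * h

namespace ContractionResolvent

variable {H : Type*} [NormedAddCommGroup H] [InnerProductSpace ℝ H] [CompleteSpace H]
  (R : ContractionResolvent H)

theorem calculus_powExpSymbol_apply (q : ℕ) (t : ℝ) (ht : 0 < t) (u : H) :
    R.calculus (powExpSymbol q t ht) u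
      = R.G 1 (R.calculus (powExpSymbol q t ht - powExpSymbol (q + 1) t ht) u) := by
  conv_lhs => rw [← unitCoordinate_mul_powExpSymbol_sub, calculus_mul, calculus_unitCoordinate]
  rfl

theorem generator_calculus_powExpSymbol (q : ℕ) (t : ℝ) (ht : 0 < t) (u : H)
    (h : R.calculus (powExpSymbol q t ht) u ∈ R.generator.domain) :
    R.generator ⟨R.calculus (powExpSymbol q t ht) u, h⟩
      = R.calculus (powExpSymbol (q + 1) t ht) u := by
  have e := R.calculus_powExpSymbol_apply q t ht u
  have e' : (⟨R.calculus (powExpSymbol q t ht) u, h⟩ : R.generator.domain) = ⟨_, e ▸ h⟩ :=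
    Subtype.ext e
  rw [e', R.generator_G_one, ← e, map_sub, sub_apply, sub_sub_cancel]

theorem generatorPow_calculus_powExpSymbol (p q : ℕ) (t : ℝ) (ht : 0 < t) (u : H) :
    R.GeneratorPow p (R.calculus (powExpSymbol q t ht) u)
      (R.calculus (powExpSymbol (q + p) t ht) u) := by
  induction p generalizing q with
  | zero => rfl
  | succ p ih =>
    have h : R.calculus (powExpSymbol q t ht) u ∈ R.generator.domain := by
      rw [calculus_powExpSymbol_apply]
      exact ⟨_, rfl⟩
    refine ⟨h, ?_⟩
    rw [generator_calculus_powExpSymbol, show q + (p + 1) = q + 1 + p by ring]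
    exact ih (q + 1)

/-- The operator `Δ ^ p T t` is the function `powExpSymbol p t` of `G 1`. -/
theorem isGeneratorPowComp_calculus (p : ℕ) (t : ℝ) (ht : 0 < t) :
    R.IsGeneratorPowComp p (R.semigroup t ht) (R.calculus (powExpSymbol p t ht)) := by
  intro u
  have h := R.generatorPow_calculus_powExpSymbol p 0 t ht u
  rwa [zero_add, powExpSymbol_zero] at h

end ContractionResolvent

/-! ### Convergence of resolvents and convergence of forms -/

theorem nonpos_of_forall_le_mul {a K : ℝ} (h : ∀ ε : ℝ, 0 < ε → a ≤ K * ε) : a ≤ 0 := by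
  have h1 : Tendsto (fun ε : ℝ => K * ε) (𝓝[>] 0) (𝓝 (K * 0)) :=
    ((continuous_const.mul continuous_id).tendsto 0).mono_left nhdsWithin_le_nhds
  rw [mul_zero] at h1
  exact ge_of_tendsto h1 (eventually_mem_nhdsWithin.mono fun ε hε => h ε hε)

namespace ContractionResolvent

variable {H : Type*} [NormedAddCommGroup H] [InnerProductSpace ℝ H] (R : ContractionResolvent H)

theorem domain_le_formDomain : R.generator.domain ≤ R.formDomain :=
  fun x hx => ⟨_, R.isApprox_const ⟨x, hx⟩⟩

theorem form_eq_preForm (x : R.generator.domain) :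
    R.form ⟨x, R.domain_le_formDomain x.2⟩ ⟨x, R.domain_le_formDomain x.2⟩ = R.preForm x x :=
  tendsto_nhds_unique (R.tendsto_formValue (u := ⟨x, R.domain_le_formDomain x.2⟩)
    (v := ⟨x, R.domain_le_formDomain x.2⟩) (R.isApprox_const x) (R.isApprox_const x))
    tendsto_const_nhds

theorem formShift_sub_comm (α : ℝ) (u v : R.formDomain) :
    R.formShift α (u - v) (u - v) = R.formShift α (v - u) (v - u) := by
  rw [← neg_sub v u]
  simp only [formShift, map_neg, LinearMap.neg_apply, neg_neg, Submodule.coe_neg, inner_neg_neg]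

theorem formDense_top : R.FormDense ⊤ := fun u ε hε =>
  ⟨u, trivial, by simpa [formShift] using hε⟩

end ContractionResolvent

namespace ConvergingHilbertSpaces

variable {H : ℕ → Type*} {Hinf : Type*}
  [∀ N, NormedAddCommGroup (H N)] [∀ N, InnerProductSpace ℝ (H N)]
  [NormedAddCommGroup Hinf] [InnerProductSpace ℝ Hinf]
  {S : ConvergingHilbertSpaces H Hinf}
  {R : ∀ N, ContractionResolvent (H N)} {Rinf : ContractionResolvent Hinf}

/-- Strong convergence of the resolvents for one parameter implies it for all parameters. -/
theorem opStronglyConverges_G_of_opStronglyConverges_G {α β : ℝ} (hα : 0 < α) (hβ : 0 < β)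
    (h : S.OpStronglyConverges (fun N => (R N).G α) (Rinf.G α)) :
    S.OpStronglyConverges (fun N => (R N).G β) (Rinf.G β) := by
  intro u uinf hu
  -- The target is chosen so that `G α` sends it to `G β uinf`. On each `H N`, `G α (w N)` is `G β`
  -- of a section converging strongly to `uinf`, and `‖G β‖ ≤ β⁻¹` absorbs the difference from `u
  -- N`. No closeness of `α` and `β` is needed.
  obtain ⟨w, hw⟩ := S.exists_stronglyConverges (uinf + (α - β) • Rinf.G β uinf)
  have h1 := h _ _ hw
  rw [← Rinf.resolvent_apply hβ hα] at h1
  have h2 := hw.add (h1.smul (β - α))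
  have e : uinf + (α - β) • Rinf.G β uinf + (β - α) • Rinf.G β uinf = uinf := by module
  rw [e] at h2
  have h3 := (hu.tendsto_norm_sub h2).const_mul β⁻¹
  rw [sub_self, norm_zero, mul_zero] at h3
  refine h1.of_tendsto_norm_sub (squeeze_zero (fun _ => norm_nonneg _) (fun N => ?_) h3)
  have h4 := (R N).norm_G_le hβ (u N - (w N + (β - α) • (R N).G α (w N)))
  rwa [map_sub, ← (R N).resolvent_apply hα hβ (w N)] at h4

/-- It is enough to verify strong convergence of the resolvents on `C`. -/
theorem opStronglyConverges_G_of_forall_C {α : ℝ} (hα : 0 < α)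
    (h : ∀ φ : S.C, S.StronglyConverges (fun N => (R N).G α (S.Ψ N φ)) (Rinf.G α φ)) :
    S.OpStronglyConverges (fun N => (R N).G α) (Rinf.G α) := by
  intro u uinf hu
  refine stronglyConverges_of_approx fun ε hε => ?_
  obtain ⟨φ, hφ⟩ := S.exists_C_norm_sub_lt uinf (mul_pos hα hε)
  refine ⟨_, _, h φ, ?_, ?_⟩
  · rw [← map_sub]
    refine (Rinf.norm_G_le hα _).trans ?_
    rw [inv_mul_le_iff₀ hα]
    exact hφ.le
  · filter_upwards [(hu.tendsto_norm_sub_Ψ φ).eventually_lt_const hφ] with N hN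
    rw [← map_sub]
    refine ((R N).norm_G_le hα _).trans ?_
    rw [inv_mul_le_iff₀ hα]
    exact hN.le

theorem tendsto_formShift_G {α : ℝ} (hα : 0 < α)
    (h : S.OpStronglyConverges (fun N => (R N).G α) (Rinf.G α))
    {u : ∀ N, H N} {uinf : Hinf} (hu : S.StronglyConverges u uinf) :
    Tendsto
      (fun N => (R N).formShift α ⟨(R N).G α (u N), (R N).G_mem_formDomain hα (u N)⟩
        ⟨(R N).G α (u N), (R N).G_mem_formDomain hα (u N)⟩) atTop
      (𝓝 (Rinf.formShift α ⟨Rinf.G α uinf, Rinf.G_mem_formDomain hα uinf⟩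
        ⟨Rinf.G α uinf, Rinf.G_mem_formDomain hα uinf⟩)) := by
  rw [Rinf.formShift_G hα]
  exact ((h _ _ hu).inner hu).congr fun N => ((R N).formShift_G hα (u N)).symm

/-- For a fixed parameter, the Yosida approximations of a section tending to `u` converge strongly
together with their energies. As the parameter grows, the limits tend to `u` and their energies to
`ℰ(u, u)`; a diagonal combines the two limits. -/
theorem recoverySequence_of_opStronglyConverges
    (h : ∀ α : ℝ, 0 < α → S.OpStronglyConverges (fun N => (R N).G α) (Rinf.G α))
    (u : Rinf.formDomain) : RecoverySequence S R Rinf u := by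
  obtain ⟨x, hx⟩ := S.exists_stronglyConverges (u : Hinf)
  have hpos : ∀ m : ℕ, (0 : ℝ) < (m : ℝ) + 1 := fun m => Nat.cast_add_one_pos m
  have hw : ∀ m : ℕ, S.StronglyConverges (fun N => ((R N).yosida (hpos m) (x N) : H N))
      (Rinf.yosida (hpos m) (u : Hinf) : Hinf) := fun m => (h _ (hpos m) _ _ hx).smul _
  have he : ∀ m : ℕ, Tendsto (fun N => (R N).preForm ((R N).yosida (hpos m) (x N))
      ((R N).yosida (hpos m) (x N))) atTop
      (𝓝 (Rinf.preForm (Rinf.yosida (hpos m) u) (Rinf.yosida (hpos m) u))) := by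
    intro m
    simp only [ContractionResolvent.preForm_yosida]
    exact ((hw m).inner (hx.sub (hw m))).const_mul _
  obtain ⟨m, hm1, hm2⟩ := exists_diagonal hw (Rinf.isApprox_yosida_of_mem u).tendsto he
    (Rinf.tendsto_preForm_yosida u)
  refine ⟨fun N => ⟨(R N).yosida (hpos (m N)) (x N), (R N).domain_le_formDomain
      ((R N).yosida (hpos (m N)) (x N)).2⟩,
    hm1, hm2.congr fun N => ((R N).form_eq_preForm _).symm⟩

/-- In the quadratic identity for the recovery sequence, the terms tend to `a - 2a + a` with `a = ⟨G
α uinf, uinf⟩`. Hence `ℰ_α(w N - G α (u N), w N - G α (u N))`, which dominates `α‖w N - G α (u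
N)‖²`, tends to zero. -/
theorem stronglyConverges_G_of_recoverySequence {α : ℝ} (hα : 0 < α) {u : ∀ N, H N} {uinf : Hinf}
    (hu : S.StronglyConverges u uinf)
    (h : Tendsto
      (fun N => (R N).formShift α ⟨(R N).G α (u N), (R N).G_mem_formDomain hα (u N)⟩
        ⟨(R N).G α (u N), (R N).G_mem_formDomain hα (u N)⟩) atTop
      (𝓝 (Rinf.formShift α ⟨Rinf.G α uinf, Rinf.G_mem_formDomain hα uinf⟩
        ⟨Rinf.G α uinf, Rinf.G_mem_formDomain hα uinf⟩)))
    (hrec : RecoverySequence S R Rinf ⟨Rinf.G α uinf, Rinf.G_mem_formDomain hα uinf⟩) :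
    S.StronglyConverges (fun N => (R N).G α (u N)) (Rinf.G α uinf) := by
  obtain ⟨w, hw, hE⟩ := hrec
  replace h := h.congr fun N => (R N).formShift_G hα (u N)
  rw [Rinf.formShift_G hα] at h
  have h1 : Tendsto (fun N => (R N).formShift α
      (w N - ⟨(R N).G α (u N), (R N).G_mem_formDomain hα (u N)⟩)
      (w N - ⟨(R N).G α (u N), (R N).G_mem_formDomain hα (u N)⟩)) atTop (𝓝 0) := by
    have h2 := ((hE.add ((hw.inner hw).const_mul α)).sub ((hw.inner hu).const_mul 2)).add h
    have h3 := Rinf.formShift_G hα uinf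
    rw [ContractionResolvent.formShift] at h3
    simp only [h3] at h2
    have e : inner ℝ (Rinf.G α uinf) uinf - 2 * inner ℝ (Rinf.G α uinf) uinf
        + inner ℝ (Rinf.G α uinf) uinf = 0 := by ring
    rw [e] at h2
    exact h2.congr fun N => ((R N).formShift_sub_G (w N) hα (u N)).symm
  refine hw.of_tendsto_norm_sub ?_
  have h2 := (h1.const_mul α⁻¹).sqrt
  rw [mul_zero, Real.sqrt_zero] at h2
  refine squeeze_zero (fun _ => norm_nonneg _) (fun N => ?_) h2
  refine Real.le_sqrt_of_sq_le ?_
  rw [le_inv_mul_iff₀ hα, norm_sub_rev]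
  exact (R N).mul_norm_sq_le_formShift α
    (w N - ⟨(R N).G α (u N), (R N).G_mem_formDomain hα (u N)⟩)

/-- Strong convergence of the resolvents implies lower semicontinuity of the energies along weakly
convergent sections. -/
theorem energy_le_liminf_of_opStronglyConverges
    (h : ∀ α : ℝ, 0 < α → S.OpStronglyConverges (fun N => (R N).G α) (Rinf.G α))
    {u : ∀ N, H N} {uinf : Hinf} (hu : S.WeaklyConverges u uinf) :
    Rinf.energy uinf ≤ liminf (fun N => (R N).energy (u N)) atTop := by
  by_contra hlt
  rw [not_le] at hlt
  obtain ⟨M, hM1, hM2⟩ := EReal.lt_iff_exists_real_btwn.1 hlt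
  refine hM2.not_ge (Rinf.energy_le_of_forall fun β hβ => ?_)
  -- The tangent at `w N` bounds the Yosida form at `u N` from below and is affine in `u N`, with a
  -- strongly convergent slope. It therefore passes to the weak limit, where it equals the Yosida
  -- form of `uinf`.
  obtain ⟨w, hw⟩ := S.exists_stronglyConverges uinf
  have hy := hw.sub ((h β hβ _ _ hw).smul β)
  have h1 := (((hu _ _ hy).const_mul β).const_mul 2).sub ((hw.inner hy).const_mul β)
  have e : ∀ a : ℝ, 2 * (β * a) - β * a = β * a := fun a => by ring
  rw [e] at h1
  refine le_of_tendsto_of_frequently h1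
    ((frequently_lt_of_liminf_lt (by isBoundedDefault) hM1).mono fun N hN => ?_)
  have h2 := ((R N).mul_inner_sub_smul_G_le_energy (u N) hβ).trans hN.le
  rw [EReal.coe_le_coe_iff] at h2
  exact ((R N).two_mul_inner_sub_le hβ (u N) (w N)).trans h2

/-- Lower semicontinuity of the energies passes to weak limits along subsequences. -/
theorem energy_le_liminf_subseq
    (h : ∀ (u : ∀ N, H N) (uinf : Hinf), S.WeaklyConverges u uinf →
      Rinf.energy uinf ≤ liminf (fun N => (R N).energy (u N)) atTop)
    {u : ∀ N, H N} {uinf : Hinf} {n : ℕ → ℕ} {hn : StrictMono n}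
    (hu : (S.subseq n hn).WeaklyConverges (fun k => u (n k)) uinf) :
    Rinf.energy uinf ≤ liminf (fun k => (R (n k)).energy (u (n k))) atTop := by
  classical
  obtain ⟨w, hw⟩ := S.exists_stronglyConverges uinf
  refine (h _ _ (weaklyConverges_ite hu hw)).trans ?_
  -- The liminf over all indices is at most the liminf along the subsequence, where the extended
  -- section agrees with `u`.
  refine (liminf_le_liminf_of_le (β := EReal) hn.tendsto_atTop).trans (le_of_eq ?_)
  rw [← liminf_comp]
  simp [Function.comp_def]

theorem _root_.RecoverySequence.subseq {u : Rinf.formDomain} (h : RecoverySequence S R Rinf u)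
    (n : ℕ → ℕ) (hn : StrictMono n) :
    RecoverySequence (S.subseq n hn) (fun k => R (n k)) Rinf u := by
  obtain ⟨w, hw, hE⟩ := h
  exact ⟨fun k => w (n k), hw.subseq n hn, hE.comp hn.tendsto_atTop⟩

/-- A weak limit of `G α (Ψ N φ)` at which the energy is lower semicontinuous is `G α φ`, and the
convergence is strong. -/
theorem eq_G_and_tendsto_norm_of_weaklyConverges {α : ℝ} (hα : 0 < α) {φ : S.C} {u : Hinf}
    (hu : S.WeaklyConverges (fun N => (R N).G α (S.Ψ N φ)) u)
    (hE : Rinf.energy u ≤ liminf (fun N => (R N).energy ((R N).G α (S.Ψ N φ))) atTop)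
    {V : Submodule ℝ Rinf.formDomain} (hV : Rinf.FormDense V)
    (hrec : ∀ v ∈ V, RecoverySequence S R Rinf v) :
    u = Rinf.G α φ ∧ Tendsto (fun N => ‖(R N).G α (S.Ψ N φ)‖) atTop (𝓝 ‖u‖) := by
  have hΨ := S.stronglyConverges_Ψ φ
  have hx := hu _ _ hΨ
  set x : ∀ N, H N := fun N => (R N).G α (S.Ψ N φ)
  set c := inner ℝ u (φ : Hinf)
  simp only [(R _).energy_G hα] at hE
  have hmem : u ∈ Rinf.formDomain := by
    -- The energies of `x N` are at most `⟨x N, Ψ N φ⟩`, which converges, so their liminf cannot be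
    -- infinite.
    by_contra hmem
    rw [ContractionResolvent.energy, dif_neg hmem, top_le_iff] at hE
    have h1 := eventually_lt_of_lt_liminf
      (lt_of_lt_of_eq (EReal.coe_lt_top (c + 1)) hE.symm) (by isBoundedDefault)
    obtain ⟨N, h2, h3⟩ := (h1.and (hx.eventually_lt_const (lt_add_one c))).exists
    rw [EReal.coe_lt_coe_iff] at h2
    nlinarith [sq_nonneg ‖x N‖, mul_nonneg hα.le (sq_nonneg ‖x N‖)]
  set E := Rinf.form ⟨u, hmem⟩ ⟨u, hmem⟩ with hEdef
  rw [Rinf.energy_eq hmem] at hE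
  have hev : ∀ ε : ℝ, 0 < ε → ∀ᶠ N in atTop, E - ε < inner ℝ (x N) (S.Ψ N φ) - α * ‖x N‖ ^ 2 := by
    intro ε hε
    have h1 := eventually_lt_of_lt_liminf
      (lt_of_lt_of_le (EReal.coe_lt_coe_iff.2 (sub_lt_self E hε)) hE) (by isBoundedDefault)
    exact h1.mono fun N hN => EReal.coe_lt_coe_iff.1 hN
  have hlow : ∀ ε : ℝ, 0 < ε → ∀ᶠ N in atTop, ‖u‖ ^ 2 - ε < ‖x N‖ ^ 2 := fun ε hε =>
    hu.eventually_lt_norm_sq (by linarith)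
  -- `⟨x N, Ψ N φ⟩` is the energy of `x N` plus `α‖x N‖²`. It tends to `c`, and both summands are
  -- lower semicontinuous.
  have hEle : E + α * ‖u‖ ^ 2 ≤ c := by
    have h1 : E + α * ‖u‖ ^ 2 - c ≤ 0 := by
      refine nonpos_of_forall_le_mul (K := 2 + α) fun ε hε => ?_
      obtain ⟨N, ⟨h1, h2⟩, h3⟩ := (((hev ε hε).and (hlow ε hε)).and
        (hx.eventually_lt_const (lt_add_of_pos_right c hε))).exists
      nlinarith
    linarith
  set g : Rinf.formDomain := ⟨Rinf.G α φ, Rinf.G_mem_formDomain hα φ⟩ with hg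
  -- Minimality of `x N` is tested against recovery sequences of `v ∈ V` near `g`. In the limit `⟨G
  -- α φ, φ⟩ - c ≤ ℰ_α(v - g, v - g) ≤ (1 + α)ε`; the `√ε` compensates the root in `FormDense`.
  have hgc : inner ℝ (Rinf.G α φ) (φ : Hinf) ≤ c := by
    have h1 : inner ℝ (Rinf.G α φ) (φ : Hinf) - c ≤ 0 := by
      refine nonpos_of_forall_le_mul (K := 1 + α) fun ε hε => ?_
      obtain ⟨v, hv, hlt⟩ := hV g (√ε) (Real.sqrt_pos.2 hε)
      rw [Real.sqrt_lt_sqrt_iff (Rinf.formShift_nonneg zero_le_one _),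
        Rinf.formShift_sub_comm] at hlt
      obtain ⟨w, hw, hwE⟩ := hrec v hv
      have h2 := ((hwE.add ((hw.inner hw).const_mul α)).sub ((hw.inner hΨ).const_mul 2)).add hx
      have h3 : 0 ≤ Rinf.formShift α v v - 2 * inner ℝ (v : Hinf) (φ : Hinf) + c :=
        ge_of_tendsto' h2 fun N => by
          have h4 := (R N).formShift_sub_G (w N) hα (S.Ψ N φ)
          have h5 := (R N).formShift_nonneg hα.le
            (w N - ⟨(R N).G α (S.Ψ N φ), (R N).G_mem_formDomain hα (S.Ψ N φ)⟩)
          rw [h4] at h5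
          exact h5
      have h4 := Rinf.formShift_sub_G v hα φ
      have h5 := Rinf.formShift_le hα.le (v - g)
      rw [hg] at h5 hlt
      have h6 : (1 + α) * Rinf.formShift 1 (v - g) (v - g) ≤ (1 + α) * ε :=
        mul_le_mul_of_nonneg_left hlt.le (by linarith)
      linarith
    linarith
  -- By the two bounds above, `ℰ_α(u - g, u - g) = ℰ_α(u, u) - 2c + ⟨G α φ, φ⟩ ≤ c - 2c + c = 0`.
  have hug : u = Rinf.G α φ := by
    have h1 := Rinf.formShift_sub_G ⟨u, hmem⟩ hα φ
    have h2 := Rinf.mul_norm_sq_le_formShift α (⟨u, hmem⟩ - g)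
    have h3 : Rinf.formShift α ⟨u, hmem⟩ ⟨u, hmem⟩ = E + α * ‖u‖ ^ 2 := by
      rw [ContractionResolvent.formShift, real_inner_self_eq_norm_sq]
    rw [hg, h1, h3] at h2
    have h4 : α * ‖u - Rinf.G α φ‖ ^ 2 ≤ 0 := by
      refine h2.trans ?_
      change E + α * ‖u‖ ^ 2 - 2 * c + _ ≤ 0
      linarith
    have h5 : ‖u - Rinf.G α φ‖ ^ 2 = 0 := by
      refine le_antisymm ?_ (sq_nonneg _)
      by_contra hpos
      push Not at hpos
      nlinarith [mul_pos hα hpos]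
    rwa [pow_eq_zero_iff two_ne_zero, norm_eq_zero, sub_eq_zero] at h5
  refine ⟨hug, ?_⟩
  have hEeq : E + α * ‖u‖ ^ 2 = c := by
    have h1 := Rinf.formShift_G hα (φ : Hinf)
    have h2 : (⟨u, hmem⟩ : Rinf.formDomain) = g := Subtype.ext hug
    have h3 : c = inner ℝ (Rinf.G α φ) (φ : Hinf) := by rw [← hug]
    rw [hEdef, h2, h3, ← h1, hug, ContractionResolvent.formShift, real_inner_self_eq_norm_sq]
  -- The sum of energy and `α‖x N‖²` converges to the sum of the lower bounds of its two terms, so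
  -- `α‖x N‖²` cannot exceed its own in the limit. The two errors `αε/2` add up to `αε`.
  have hsq : Tendsto (fun N => ‖x N‖ ^ 2) atTop (𝓝 (‖u‖ ^ 2)) := by
    rw [Metric.tendsto_nhds]
    intro ε hε
    have hε' : 0 < α * ε / 2 := by positivity
    filter_upwards [hev _ hε', hlow ε hε,
      hx.eventually_lt_const (lt_add_of_pos_right c hε')] with N h1 h2 h3
    rw [Real.dist_eq, abs_lt]
    refine ⟨by linarith, ?_⟩
    have h4 : α * (‖x N‖ ^ 2 - ‖u‖ ^ 2) < α * ε := by linarith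
    exact lt_of_mul_lt_mul_left h4 hα.le
  simpa [Real.sqrt_sq (norm_nonneg _)] using hsq.sqrt

/-- By weak compactness every subsequence has a weakly convergent further subsequence. Its limit is
always `G α φ` and the norms converge too, so the whole sequence converges strongly. -/
theorem stronglyConverges_G_Ψ [CompleteSpace Hinf] [TopologicalSpace.SeparableSpace Hinf]
    {α : ℝ} (hα : 0 < α) (φ : S.C)
    (h : ∀ (u : Hinf) (n : ℕ → ℕ) (hn : StrictMono n),
      (S.subseq n hn).WeaklyConverges (fun k => (R (n k)).G α (S.Ψ (n k) φ)) u →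
        Rinf.energy u ≤ liminf (fun k => (R (n k)).energy ((R (n k)).G α (S.Ψ (n k) φ))) atTop)
    {V : Submodule ℝ Rinf.formDomain} (hV : Rinf.FormDense V)
    (hrec : ∀ v ∈ V, RecoverySequence S R Rinf v) :
    S.StronglyConverges (fun N => (R N).G α (S.Ψ N φ)) (Rinf.G α φ) := by
  obtain ⟨B, hB⟩ := (S.tendsto_norm_Ψ φ).bddAbove_range
  have hM : ∀ N, ‖(R N).G α (S.Ψ N φ)‖ ≤ α⁻¹ * B := fun N =>
    ((R N).norm_G_le hα _).trans
      (mul_le_mul_of_nonneg_left (hB ⟨N, rfl⟩) (inv_nonneg.2 hα.le))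
  have key : ∀ ns : ℕ → ℕ, Tendsto ns atTop atTop → ∃ (ms : ℕ → ℕ) (hs : StrictMono (ns ∘ ms)),
      (S.subseq (ns ∘ ms) hs).StronglyConverges
        (fun k => (R (ns (ms k))).G α (S.Ψ (ns (ms k)) φ)) (Rinf.G α φ) := by
    intro ns hns
    -- `ns` merely tends to infinity, whereas convergence along a subsequence needs strictly
    -- increasing indices.
    obtain ⟨a, -, ha⟩ := strictMono_subseq_of_tendsto_atTop hns
    obtain ⟨b, hb, u, hu⟩ := (S.subseq (ns ∘ a) ha).exists_subseq_weaklyConverges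
      (u := fun k => (R (ns (a k))).G α (S.Ψ (ns (a k)) φ)) (fun k => hM _)
    have hs : StrictMono (ns ∘ (a ∘ b)) := ha.comp hb
    have hu' : (S.subseq (ns ∘ (a ∘ b)) hs).WeaklyConverges
        (fun k => (R (ns (a (b k)))).G α (S.Ψ (ns (a (b k))) φ)) u := hu
    have h1 := eq_G_and_tendsto_norm_of_weaklyConverges (S := S.subseq (ns ∘ (a ∘ b)) hs)
      (R := fun k => R (ns (a (b k)))) (φ := φ) hα hu' (h u _ hs hu') hV
      fun v hv => (hrec v hv).subseq _ hs
    refine ⟨a ∘ b, hs, ?_, ?_⟩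
    · intro ψ
      rw [← h1.1]
      exact hu' _ _ ((S.subseq _ hs).stronglyConverges_Ψ ψ)
    · rw [← h1.1]
      exact h1.2
  refine ⟨fun ψ => tendsto_of_subseq_tendsto fun ns hns => ?_,
    tendsto_of_subseq_tendsto fun ns hns => ?_⟩
  · obtain ⟨ms, hs, h1⟩ := key ns hns
    exact ⟨ms, h1.1 ψ⟩
  · obtain ⟨ms, hs, h1⟩ := key ns hns
    exact ⟨ms, h1.2⟩

end ConvergingHilbertSpaces

end

/-! ### The equivalences -/

theorem theorem3p4 {H : ℕ → Type*} {Hinf : Type*}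
    [∀ N, NormedAddCommGroup (H N)] [∀ N, InnerProductSpace ℝ (H N)] [∀ N, CompleteSpace (H N)]
    [∀ N, TopologicalSpace.SeparableSpace (H N)]
    [NormedAddCommGroup Hinf] [InnerProductSpace ℝ Hinf] [CompleteSpace Hinf]
    [TopologicalSpace.SeparableSpace Hinf]
    (S : ConvergingHilbertSpaces H Hinf)
    (R : ∀ N, ContractionResolvent (H N)) (Rinf : ContractionResolvent Hinf) :
    List.TFAE [
      -- strong convergence of the resolvents
      ∀ α : ℝ, 0 < α → S.OpStronglyConverges (fun N => (R N).G α) (Rinf.G α),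
      -- convergence of the resolvent energies, and recovery sequences on the whole form domain
      (∀ (u : ∀ N, H N) (uinf : Hinf) (α : ℝ) (hα : 0 < α), S.StronglyConverges u uinf →
        Filter.Tendsto
          (fun N => (R N).formShift α ⟨(R N).G α (u N), (R N).G_mem_formDomain hα (u N)⟩
            ⟨(R N).G α (u N), (R N).G_mem_formDomain hα (u N)⟩)
          Filter.atTop
          (nhds (Rinf.formShift α ⟨Rinf.G α uinf, Rinf.G_mem_formDomain hα uinf⟩
            ⟨Rinf.G α uinf, Rinf.G_mem_formDomain hα uinf⟩))) ∧
      (∀ u : Rinf.formDomain, RecoverySequence S R Rinf u),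
      -- lower semicontinuity along weakly convergent sections, and recovery on a dense subspace
      (∀ (u : ∀ N, H N) (uinf : Hinf), S.WeaklyConverges u uinf →
        Rinf.energy uinf ≤ Filter.liminf (fun N => (R N).energy (u N)) Filter.atTop) ∧
      (∃ V : Submodule ℝ Rinf.formDomain, Rinf.FormDense V ∧
        ∀ u ∈ V, RecoverySequence S R Rinf u),
      -- the same with lower semicontinuity only at weak accumulation points, for one α
      (∃ α : ℝ, 0 < α ∧ ∀ (φ : S.C) (u : Hinf) (n : ℕ → ℕ) (hn : StrictMono n),
        (S.subseq n hn).WeaklyConverges (fun k => (R (n k)).G α (S.Ψ (n k) φ)) u →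
          Rinf.energy u ≤ Filter.liminf
            (fun k => (R (n k)).energy ((R (n k)).G α (S.Ψ (n k) φ))) Filter.atTop) ∧
      (∃ V : Submodule ℝ Rinf.formDomain, Rinf.FormDense V ∧
        ∀ u ∈ V, RecoverySequence S R Rinf u),
      -- strong convergence of Δ ^ p T t
      ∀ (t : ℝ) (ht : 0 < t) (p : ℕ),
        ∃ (L : ∀ N, H N →L[ℝ] H N) (Linf : Hinf →L[ℝ] Hinf),
          (∀ N, (R N).IsGeneratorPowComp p ((R N).semigroup t ht) (L N)) ∧
          Rinf.IsGeneratorPowComp p (Rinf.semigroup t ht) Linf ∧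
          S.OpStronglyConverges L Linf] := by

  tfae_have 1 → 2 := fun h =>
    ⟨fun u uinf α hα hu => S.tendsto_formShift_G hα (h α hα) hu,
      S.recoverySequence_of_opStronglyConverges h⟩
  tfae_have 2 → 1 := fun h α hα u uinf hu =>
    S.stronglyConverges_G_of_recoverySequence hα hu (h.1 u uinf α hα hu) (h.2 _)
  tfae_have 1 → 3 := fun h =>
    ⟨fun u uinf hu => S.energy_le_liminf_of_opStronglyConverges h hu,
      ⊤, Rinf.formDense_top, fun u _ => S.recoverySequence_of_opStronglyConverges h u⟩
  tfae_have 3 → 4 := fun h =>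
    ⟨⟨1, one_pos, fun φ u n hn hu => S.energy_le_liminf_subseq
      (u := fun N => (R N).G 1 (S.Ψ N φ)) h.1 hu⟩, h.2⟩
  tfae_have 4 → 1 := by
    rintro ⟨⟨α, hα, h⟩, V, hV, hrec⟩ β hβ
    exact S.opStronglyConverges_G_of_opStronglyConverges_G hα hβ
      (S.opStronglyConverges_G_of_forall_C hα fun φ => S.stronglyConverges_G_Ψ hα φ (h φ) hV hrec)
  tfae_have 1 → 5 := by
    intro h t ht p
    refine ⟨fun N => (R N).calculus (powExpSymbol p t ht), Rinf.calculus (powExpSymbol p t ht),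
      fun N => (R N).isGeneratorPowComp_calculus p t ht,
      Rinf.isGeneratorPowComp_calculus p t ht, ?_⟩
    have h1 : unitCoordinate ∈ S.convergentSymbols R Rinf := by
      change S.OpStronglyConverges _ _
      simpa only [ContractionResolvent.calculus_unitCoordinate] using h 1 one_pos
    have h2 := S.convergentSymbols_eq_top h1 Subtype.val_injective
    exact h2.ge (Algebra.mem_top (x := powExpSymbol p t ht))
  tfae_have 5 → 1 := by
    intro h β hβ
    -- One time and `p = 0` suffice: `L` is then the semigroup at time 1, whose symbol is injective.
    obtain ⟨L, Linf, hL, hLinf, hconv⟩ := h 1 one_pos 0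
    have h1 : expSymbol 1 one_pos ∈ S.convergentSymbols R Rinf := by
      have e : (fun N => (R N).calculus (expSymbol 1 one_pos)) = L :=
        funext fun N => ContinuousLinearMap.ext (hL N)
      have e' : Rinf.calculus (expSymbol 1 one_pos) = Linf := ContinuousLinearMap.ext hLinf
      change S.OpStronglyConverges _ _
      rwa [e, e']
    have h2 := S.convergentSymbols_eq_top h1 (expSymbol_injective 1 one_pos)
    have h3 : S.OpStronglyConverges _ _ := h2.ge (Algebra.mem_top (x := unitCoordinate))
    simp only [ContractionResolvent.calculus_unitCoordinate] at h3
    exact S.opStronglyConverges_G_of_opStronglyConverges_G one_pos hβ h3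
  tfae_finish
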